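/- Let $0<q<1$. Write $(x;q^2)_n=\prod_{j=0}^{n-1}(1-xq^{2j})$ for $n\in\mathbb Z_{\ge 0}\cup\{\infty\}$, $\theta(x;q^2)=(x;q^2)_\infty(q^2/x;q^2)_\infty$, $(x_1,\dots,x_k;q^2)_\infty=\prod_i (x_i;q^2)_\infty$, and let $x^{\pm1}$ in such a symbol denote the product over both signs. Let $${}_{r+1}\varphi_r\!\left(\begin{matrix}A_1,\dots,A_{r+1}\\ B_1,\dots,B_r\end{matrix};q^2,w\right)=\sum_{n\ge0}\frac{(A_1;q^2)_n\cdots(A_{r+1};q^2)_n}{(B_1;q^2)_n\cdots(B_r;q^2)_n\,(q^2;q^2)_n}\,w^n\qquad(|w|<1),$$ where ${}_2\varphi_1$ also denotes the one-valued analytic continuation of this series in $w$ to $\mathbb C\setminus\{q^{-2k}:k\in\mathbb Z_{\ge0}\}$. Let $\lambda,\varepsilon\in\mathbb R$ and let $s,u,t,v,x,y\in\mathbb C^\times$ satisfy $|ux|,|u/x|,|vy|,|v/y|\le q^2$ and $|s/u|,|t/v|\le q$. Put $$a=sq^{1-2i\lambda},\quad b=sq^{1+2i\lambda},\quad c=\frac{tvq}{u},\quad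 d=\frac{qv}{ut},\quad \kappa=q^{-1-2\varepsilon+2i\lambda},\quad \tilde a=\frac{svq}{u},$$ and suppose that $\kappa\notin q^{2\mathbb Z}$ and $ad\notin q^{2\mathbb Z}$. Then $\tilde a^2=abcd/q^2$, and $$\sum_{n\in\mathbb Z}{}_2\varphi_1\!\left(\begin{matrix}ax,a/x\\ ab\end{matrix};q^2,\kappa q^{2-2n}\right){}_2\varphi_1\!\left(\begin{matrix}bcy/\tilde a,\,bc/(y\tilde a)\\ cq^2/d\end{matrix};q^2,\frac{q^{2n}}{\kappa}\right)\left(\frac{q^2}{ad}\right)^n$$ converges absolutely, with sum $$\frac{(q^2,ac,bcy^{\pm1}/\tilde a;q^2)_\infty\,\theta(ad\kappa;q^2)}{(q^2/ad,\,cq^2/d,\,\tilde ay^{\pm1};q^2)_\infty\,\theta(1/\kappa;q^2)}\;{}_4\varphi_3\!\left(\begin{matrix}ax,a/x,\tilde ay,\tilde a/y\\ ab,ac,ad\end{matrix};q^2,q^2\right)$$ $$+\;\frac{(q^2,q^2b/d,ax^{\pm1};q^2)_\infty\,\theta(ad\kappa;q^2)}{(ab,\,ad/q^2,\,q^2x^{\pm1}/d;q^2)_\infty\,\theta(1/\kappa;q^2)}\;{}_4\varphi_3\!\left(\begin{matrix}q^2x/d,\,q^2/(dx),\,bcy/\tilde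 a,\,bc/(y\tilde a)\\ q^2b/d,\,q^2c/d,\,q^4/(ad)\end{matrix};q^2,q^2\right).$$ Equivalently, this sum equals $$\frac{(q^2,bcy^{\pm1}/\tilde a;q^2)_\infty\,\theta(ad\kappa;q^2)}{(ab,\,cq^2/d,\,\tilde ay^{\pm1};q^2)_\infty\,\theta(1/\kappa;q^2)}\;\psi_y(x;a,b,c,d\,|\,q^2),$$ where, with $\tilde d=ad/\tilde a$, the Askey--Wilson function is $$\psi_\gamma(x;a,b,c,d\,|\,q^2)=\frac{(ab,ac;q^2)_\infty}{(q^2/ad;q^2)_\infty}\,{}_4\varphi_3\!\left(\begin{matrix}ax,a/x,\tilde a\gamma,\tilde a/\gamma\\ ab,ac,ad\end{matrix};q^2,q^2\right)+\frac{(ax^{\pm1},\tilde a\gamma^{\pm1},q^2b/d,q^2c/d;q^2)_\infty}{(q^2x^{\pm1}/d,\,q^2\gamma^{\pm1}/\tilde d,\,ad/q^2;q^2)_\infty}\,{}_4\varphi_3\!\left(\begin{matrix}q^2x/d,\,q^2/(dx),\,q^2\gamma/\tilde d,\,q^2/(\tilde d\gamma)\\ q^2b/d,\,q^2c/d,\,q^4/(ad)\end{matrix};q^2,q^2\right).$$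 -/

import Mathlib

noncomputable section

/-- The finite `Q`-shifted factorial `(x;Q)_n = ∏_{j<n} (1 - x Q^j)`. -/
def qPoch (x Q : ℂ) (n : ℕ) : ℂ := ∏ j ∈ Finset.range n, (1 - x * Q ^ j)

/-- The infinite `Q`-shifted factorial `(x;Q)_∞ = ∏_{j≥0} (1 - x Q^j)`, for `|Q| < 1`. -/
def qPochInf (x Q : ℂ) : ℂ := ∏' j : ℕ, (1 - x * Q ^ j)

/-- The theta function `θ(x;Q) = (x;Q)_∞ (Q/x;Q)_∞`, for `x ≠ 0`. -/
def qTheta (x Q : ℂ) : ℂ := qPochInf x Q * qPochInf (Q / x) Q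

/-- The basic hypergeometric series `₂φ₁(A, B; C; Q, w)`, for `|w| < 1`. -/
def phi21Series (A B C Q w : ℂ) : ℂ :=
  ∑' n : ℕ, (qPoch A Q n * qPoch B Q n) / (qPoch C Q n * qPoch Q Q n) * w ^ n

/-- The complement in `ℂ` of the points `1, Q⁻¹, Q⁻², …`. For `0 < Q < 1` these points lie on
`[1, ∞)`, so this open connected set contains `ℂ \ [1, ∞)`. -/
def phi21Domain (Q : ℂ) : Set ℂ := {w | ∀ k : ℕ, w * Q ^ k ≠ 1}

/-- `F` is the one-valued analytic continuation of the series `₂φ₁(A, B; C; Q, ·)` from the open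
unit disc to `phi21Domain Q`. -/
def IsPhi21Continuation (A B C Q : ℂ) (F : ℂ → ℂ) : Prop :=
  DifferentiableOn ℂ F (phi21Domain Q) ∧ ∀ w : ℂ, ‖w‖ < 1 → F w = phi21Series A B C Q w

open Classical in
/-- The function `₂φ₁(A, B; C; Q, w)`: the analytic continuation of the series in `w`. Its values
on `phi21Domain Q` are the unique ones (identity theorem). -/
def phi21 (A B C Q w : ℂ) : ℂ :=
  if h : ∃ F : ℂ → ℂ, IsPhi21Continuation A B C Q F then h.choose w else 0

/-- The basic hypergeometric series `₄φ₃(A₁, A₂, A₃, A₄; B₁, B₂, B₃; Q, w)`, for `|w| < 1`. -/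
def phi43 (A₁ A₂ A₃ A₄ B₁ B₂ B₃ Q w : ℂ) : ℂ :=
  ∑' n : ℕ, (qPoch A₁ Q n * qPoch A₂ Q n * qPoch A₃ Q n * qPoch A₄ Q n) /
    (qPoch B₁ Q n * qPoch B₂ Q n * qPoch B₃ Q n * qPoch Q Q n) * w ^ n

/-- The Askey-Wilson function `ψ_γ(x; A, B, C, D | Q)`. The argument `At` is the choice of
square root `√(ABCD/Q)`, the first dual parameter; the fourth dual parameter is `AD/At`. -/
def askeyWilson (γ x A B C D At Q : ℂ) : ℂ :=
  qPochInf (A * B) Q * qPochInf (A * C) Q / qPochInf (Q / (A * D)) Q *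
      phi43 (A * x) (A / x) (At * γ) (At / γ) (A * B) (A * C) (A * D) Q Q +
    qPochInf (A * x) Q * qPochInf (A / x) Q * qPochInf (At * γ) Q * qPochInf (At / γ) Q *
        qPochInf (Q * B / D) Q * qPochInf (Q * C / D) Q /
      (qPochInf (Q * x / D) Q * qPochInf (Q / (D * x)) Q *
        qPochInf (Q * γ / (A * D / At)) Q * qPochInf (Q / ((A * D / At) * γ)) Q *
        qPochInf (A * D / Q) Q) *
      phi43 (Q * x / D) (Q / (D * x)) (Q * γ / (A * D / At)) (Q / ((A * D / At) * γ))
        (Q * B / D) (Q * C / D) (Q ^ 2 / (A * D)) Q Q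

end

/-! Throughout `Q = q²`. The key is an expansion of `₂φ₁` that separates its argument from its
parameters. Up to a constant, the coefficient `(A)_j (B)_j / (C)_j` is the value at `Q ^ j` of `f(x)
= (Cx)_∞ / ((Ax)_∞ (Bx)_∞)`. Inserting the Taylor series `f(x) = ∑ e_m x ^ m` and summing over `j`
by Euler's formula turns `₂φ₁` into a constant times `∑ e_m / (w Q ^ m)_∞`. This series converges
off the poles, so it is the analytic continuation (`phi21_eq`).

With both factors expanded, the sum over `n ∈ ℤ` acts only on `z ^ n / ((κ Q ^ (1-n+m))_∞ (Q ^ (n+l)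
/ κ)_∞)`, where `z = Q / (ad)`. After the shift `n ↦ n + l` the two products combine into a theta
function and a finite factor `(κ Q ^ (1-n))_p` with `p = m + l`, giving the bilateral series
`thetaPoch`. Its dependence on `κ` is only through `θ(z/κ) / θ(z)` (`qTheta_mul_thetaPoch`), so `κ =
1` suffices. There it is a difference of two unilateral series `tailSum`, at `z⁻¹` and at `z`
(`thetaPoch_one`).

In the `k`-th term of `tailSum` the index `p = m + l` enters only as `Q ^ (mk) Q ^ (lk)`. The sums
over `m` and `l` therefore decouple and rebuild the quotients of infinite products at `Q ^ k`; the
remaining sum over `k` is a `₄φ₃` (`hasSum_mul_tailSum`, `tsum_tailTerm_mul`). The two unilateral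
series yield the two `₄φ₃` of the formula. All interchanges rest on the absolute convergence of the
triple series (`summable_tripleTerm`). -/

open Filter Topology

/-! ### Shifted factorials and Euler's two expansions. -/

section qPochhammer

variable {Q : ℂ}

lemma qPoch_zero (x Q : ℂ) : qPoch x Q 0 = 1 := by simp [qPoch]

lemma qPoch_succ (x Q : ℂ) (n : ℕ) : qPoch x Q (n + 1) = qPoch x Q n * (1 - x * Q ^ n) := by
  simp [qPoch, Finset.prod_range_succ]

lemma qPoch_add (x Q : ℂ) (m n : ℕ) :
    qPoch x Q (m + n) = qPoch x Q m * qPoch (x * Q ^ m) Q n := by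
  simp only [qPoch, Finset.prod_range_add]
  congr 1
  exact Finset.prod_congr rfl fun i _ ↦ by ring

lemma summable_mul_pow (hQ : ‖Q‖ < 1) (x : ℂ) : Summable fun j : ℕ ↦ x * Q ^ j :=
  (summable_geometric_of_norm_lt_one hQ).mul_left x

lemma multipliable_one_sub_mul_pow (hQ : ‖Q‖ < 1) (x : ℂ) :
    Multipliable fun j : ℕ ↦ 1 - x * Q ^ j := by
  simpa [sub_eq_add_neg] using
    Complex.multipliable_one_add_of_summable (summable_mul_pow hQ x).neg

lemma tendsto_qPoch (hQ : ‖Q‖ < 1) (x : ℂ) :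
    Tendsto (qPoch x Q) atTop (𝓝 (qPochInf x Q)) :=
  (multipliable_one_sub_mul_pow hQ x).tendsto_prod_tprod_nat

lemma qPochInf_eq_mul (hQ : ‖Q‖ < 1) (x : ℂ) (n : ℕ) :
    qPochInf x Q = qPoch x Q n * qPochInf (x * Q ^ n) Q := by
  have h1 := (tendsto_qPoch hQ (x * Q ^ n)).const_mul (qPoch x Q n)
  have h2 : Tendsto (fun m ↦ qPoch x Q (n + m)) atTop (𝓝 (qPochInf x Q)) := by
    simpa [Function.comp_def, add_comm] using (tendsto_qPoch hQ x).comp (tendsto_add_atTop_nat n)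
  simp only [← qPoch_add] at h1
  exact tendsto_nhds_unique h2 h1

lemma qPochInf_eq_one_sub_mul (hQ : ‖Q‖ < 1) (x : ℂ) :
    qPochInf x Q = (1 - x) * qPochInf (x * Q) Q := by
  simpa [qPoch] using qPochInf_eq_mul hQ x 1

lemma qPochInf_ne_zero (hQ : ‖Q‖ < 1) {x : ℂ} (hx : ∀ j : ℕ, x * Q ^ j ≠ 1) :
    qPochInf x Q ≠ 0 := by
  have := tprod_one_add_ne_zero_of_summable (R := ℂ) (f := fun j : ℕ ↦ -(x * Q ^ j))
    (fun j h ↦ hx j (by linear_combination -h)) (by simpa using (summable_mul_pow hQ x).norm)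
  simpa [qPochInf, sub_eq_add_neg] using this

lemma mul_pow_ne_one (hQ : ‖Q‖ < 1) {x : ℂ} (hx : ‖x‖ < 1) (j : ℕ) : x * Q ^ j ≠ 1 := by
  intro h
  have h1 : ‖x * Q ^ j‖ < 1 := by
    rw [norm_mul, norm_pow]
    calc ‖x‖ * ‖Q‖ ^ j ≤ ‖x‖ * 1 := by gcongr; exact pow_le_one₀ (norm_nonneg _) hQ.le
      _ < 1 := by simpa using hx
  simp [h] at h1

lemma qPochInf_ne_zero_of_norm_lt (hQ : ‖Q‖ < 1) {x : ℂ} (hx : ‖x‖ < 1) : qPochInf x Q ≠ 0 :=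
  qPochInf_ne_zero hQ (mul_pow_ne_one hQ hx)

lemma qPoch_ne_zero {x : ℂ} (hx : ∀ j : ℕ, x * Q ^ j ≠ 1) (n : ℕ) : qPoch x Q n ≠ 0 :=
  Finset.prod_ne_zero_iff.mpr fun j _ h ↦ hx j (by linear_combination -h)

lemma qPoch_ne_zero_of_norm_lt (hQ : ‖Q‖ < 1) {x : ℂ} (hx : ‖x‖ < 1) (n : ℕ) :
    qPoch x Q n ≠ 0 :=
  qPoch_ne_zero (mul_pow_ne_one hQ hx) n

lemma exists_norm_inv_qPoch_le (hQ : ‖Q‖ < 1) : ∃ M : ℝ, 0 ≤ M ∧ ∀ j, ‖(qPoch Q Q j)⁻¹‖ ≤ M := by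
  have h := ((tendsto_qPoch hQ Q).inv₀ (qPochInf_ne_zero_of_norm_lt hQ hQ)).norm
  obtain ⟨M, hM⟩ := h.bddAbove_range
  exact ⟨M, (norm_nonneg _).trans (hM ⟨0, rfl⟩), fun j ↦ hM ⟨j, rfl⟩⟩

lemma differentiableOn_tsum_mul_pow {a : ℕ → ℂ} {r : ℝ} (h : Summable fun j ↦ ‖a j‖ * r ^ j) :
    DifferentiableOn ℂ (fun w ↦ ∑' j, a j * w ^ j) (Metric.ball 0 r) := by
  refine Complex.differentiableOn_tsum_of_summable_norm h (fun j ↦ by fun_prop)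
    Metric.isOpen_ball fun j w hw ↦ ?_
  rw [norm_mul, norm_pow]
  gcongr
  exact (mem_ball_zero_iff.mp hw).le

/-- A power series tends to its constant coefficient along `w Q ^ n`. -/
lemma tendsto_tsum_mul_pow_mul_pow (hQ : ‖Q‖ < 1) {a : ℕ → ℂ} {r : ℝ} (hr : 0 < r)
    (h : Summable fun j ↦ ‖a j‖ * r ^ j) (w : ℂ) :
    Tendsto (fun n : ℕ ↦ ∑' j, a j * (w * Q ^ n) ^ j) atTop (𝓝 (a 0)) := by
  have hc := ((differentiableOn_tsum_mul_pow h).continuousOn).continuousAt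
    (Metric.ball_mem_nhds 0 hr)
  have h0 : ∑' j, a j * (0 : ℂ) ^ j = a 0 := by
    rw [tsum_eq_single 0 (by intro j hj; simp [hj])]; simp
  have ht : Tendsto (fun n : ℕ ↦ w * Q ^ n) atTop (𝓝 0) := by
    simpa using (tendsto_pow_atTop_nhds_zero_of_norm_lt_one hQ).const_mul w
  have := hc.tendsto.comp ht
  rwa [h0] at this

lemma summable_norm_pow_div_qPoch (hQ : ‖Q‖ < 1) {r : ℝ} (hr0 : 0 ≤ r) (hr : r < 1) :
    Summable fun j : ℕ ↦ ‖(qPoch Q Q j)⁻¹‖ * r ^ j := by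
  obtain ⟨M, -, hM⟩ := exists_norm_inv_qPoch_le hQ
  refine Summable.of_nonneg_of_le (fun j ↦ by positivity) (fun j ↦ ?_)
    ((summable_geometric_of_lt_one hr0 hr).mul_left M)
  gcongr
  exact hM j

/-- Euler's expansion of `1 / (w; Q)_∞`. -/
lemma hasSum_inv_qPochInf (hQ : ‖Q‖ < 1) {w : ℂ} (hw : ‖w‖ < 1) :
    HasSum (fun j : ℕ ↦ (qPoch Q Q j)⁻¹ * w ^ j) (qPochInf w Q)⁻¹ := by
  set F : ℂ → ℂ := fun w ↦ ∑' j : ℕ, (qPoch Q Q j)⁻¹ * w ^ j with hF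
  have hs : ∀ {w : ℂ}, ‖w‖ < 1 → Summable fun j : ℕ ↦ (qPoch Q Q j)⁻¹ * w ^ j := fun {w} hw ↦
    Summable.of_norm (by simpa using summable_norm_pow_div_qPoch hQ (norm_nonneg w) hw)
  have hwQ : ∀ {w : ℂ}, ‖w‖ < 1 → ‖w * Q‖ < 1 := fun {w} hw ↦ by
    rw [norm_mul]; exact mul_lt_one_of_nonneg_of_lt_one_left (norm_nonneg _) hw hQ.le
  -- The series obeys the first-order `Q`-difference equation of `1 / (w; Q)_∞`. Iterating it moves
  -- the argument to `0`, where the series equals `1`.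
  have hrec : ∀ {w : ℂ}, ‖w‖ < 1 → F (w * Q) = (1 - w) * F w := by
    intro w hw
    have h1 : F w = 1 + ∑' j : ℕ, (qPoch Q Q (j + 1))⁻¹ * w ^ (j + 1) := by
      simp only [hF]; rw [(hs hw).tsum_eq_zero_add]; simp [qPoch_zero]
    have h2 : F (w * Q) = 1 + ∑' j : ℕ, (qPoch Q Q (j + 1))⁻¹ * (w * Q) ^ (j + 1) := by
      simp only [hF]; rw [(hs (hwQ hw)).tsum_eq_zero_add]; simp [qPoch_zero]
    have h3 : ∑' j : ℕ, (qPoch Q Q (j + 1))⁻¹ * w ^ (j + 1) -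
        ∑' j : ℕ, (qPoch Q Q (j + 1))⁻¹ * (w * Q) ^ (j + 1) = w * F w := by
      rw [← ((summable_nat_add_iff 1).mpr (hs hw)).tsum_sub
        ((summable_nat_add_iff 1).mpr (hs (hwQ hw))), ← tsum_mul_left]
      refine tsum_congr fun j ↦ ?_
      have ha := qPoch_ne_zero_of_norm_lt hQ hQ j
      have hb := qPoch_ne_zero_of_norm_lt hQ hQ (j + 1)
      rw [qPoch_succ] at hb ⊢
      have hc := right_ne_zero_of_mul hb
      field_simp
      ring
    linear_combination h2 - h1 - h3
  have hpow : ∀ n : ℕ, F (w * Q ^ n) = qPoch w Q n * F w := by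
    intro n
    induction n with
    | zero => simp [qPoch_zero]
    | succ n ih =>
      rw [pow_succ, ← mul_assoc, hrec, ih, qPoch_succ]
      · ring
      · rw [norm_mul, norm_pow]
        exact (mul_le_of_le_one_right (norm_nonneg _) (pow_le_one₀ (norm_nonneg _) hQ.le)).trans_lt
          hw
  have h1 := tendsto_tsum_mul_pow_mul_pow hQ (r := 1 / 2) (by norm_num)
    (summable_norm_pow_div_qPoch hQ (by norm_num) (by norm_num)) w
  have h2 : Tendsto (fun n : ℕ ↦ F (w * Q ^ n)) atTop (𝓝 (qPochInf w Q * F w)) := by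
    simp only [hpow]
    exact (tendsto_qPoch hQ w).mul_const _
  have h3 := tendsto_nhds_unique h2 h1
  have h4 : F w = (qPochInf w Q)⁻¹ := by
    rw [qPoch_zero, inv_one] at h3
    exact eq_inv_of_mul_eq_one_right h3
  rw [← h4]
  exact (hs hw).hasSum

lemma summable_pow_choose_two (hQ : ‖Q‖ < 1) (x : ℂ) :
    Summable fun j : ℕ ↦ x ^ j * Q ^ j.choose 2 := by
  -- The ratio test needs nonzero terms; in the degenerate cases only `j = 0, 1` can contribute.
  by_cases hz : x = 0 ∨ Q = 0
  · refine summable_of_ne_finset_zero (s := Finset.range 2) fun j hj ↦ ?_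
    have hj : 2 ≤ j := by simpa [Nat.lt_iff_add_one_le] using hj
    have : j.choose 2 ≠ 0 := (Nat.choose_pos hj).ne'
    rcases hz with h | h
    · simp [h, show j ≠ 0 by omega]
    · simp [h, this]
  · push Not at hz
    refine summable_of_ratio_test_tendsto_lt_one zero_lt_one
      (Eventually.of_forall fun j ↦ mul_ne_zero (pow_ne_zero _ hz.1) (pow_ne_zero _ hz.2)) ?_
    have : Tendsto (fun n : ℕ ↦ ‖x * Q ^ n‖) atTop (𝓝 0) := by
      simpa using ((tendsto_pow_atTop_nhds_zero_of_norm_lt_one hQ).const_mul x).norm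
    refine this.congr fun n ↦ ?_
    rw [← norm_div, Nat.choose_succ_succ' n 1, Nat.choose_one_right]
    congr 1
    have h1 := pow_ne_zero n hz.1
    have h2 := pow_ne_zero (n.choose 2) hz.2
    field_simp
    ring

/-- The coefficients in Euler's expansion of `(x; Q)_∞`. -/
noncomputable def eulerCoeff (Q : ℂ) (j : ℕ) : ℂ := (-1) ^ j * Q ^ j.choose 2 * (qPoch Q Q j)⁻¹

lemma summable_norm_eulerCoeff (hQ : ‖Q‖ < 1) (r : ℝ) (hr : 0 ≤ r) :
    Summable fun j : ℕ ↦ ‖eulerCoeff Q j‖ * r ^ j := by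
  obtain ⟨M, -, hM⟩ := exists_norm_inv_qPoch_le hQ
  have := ((summable_pow_choose_two hQ (r : ℂ)).norm).mul_left M
  refine Summable.of_nonneg_of_le (fun j ↦ by positivity) (fun j ↦ ?_) this
  simp only [eulerCoeff, norm_mul, norm_pow, norm_neg, norm_one, one_pow, one_mul,
    Complex.norm_real, Real.norm_of_nonneg hr]
  calc ‖Q‖ ^ j.choose 2 * ‖(qPoch Q Q j)⁻¹‖ * r ^ j ≤ ‖Q‖ ^ j.choose 2 * M * r ^ j := by
        gcongr; exact hM j
    _ = _ := by ring

lemma summable_norm_eulerCoeff_mul_pow (hQ : ‖Q‖ < 1) (x : ℂ) :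
    Summable fun j : ℕ ↦ ‖eulerCoeff Q j * x ^ j‖ := by
  simpa using summable_norm_eulerCoeff hQ ‖x‖ (norm_nonneg x)

/-- Euler's expansion of `(x; Q)_∞`. -/
lemma hasSum_qPochInf (hQ : ‖Q‖ < 1) (x : ℂ) :
    HasSum (fun j : ℕ ↦ eulerCoeff Q j * x ^ j) (qPochInf x Q) := by
  set F : ℂ → ℂ := fun x ↦ ∑' j : ℕ, eulerCoeff Q j * x ^ j with hF
  have hs : ∀ x : ℂ, Summable fun j : ℕ ↦ eulerCoeff Q j * x ^ j := fun x ↦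
    Summable.of_norm (summable_norm_eulerCoeff_mul_pow hQ x)
  have h0 : eulerCoeff Q 0 = 1 := by simp [eulerCoeff, qPoch_zero]
  have hrec : ∀ x : ℂ, F x = (1 - x) * F (x * Q) := by
    intro x
    have h1 : F x = 1 + ∑' j : ℕ, eulerCoeff Q (j + 1) * x ^ (j + 1) := by
      simp only [hF]; rw [(hs x).tsum_eq_zero_add]; simp [h0]
    have h2 : F (x * Q) = 1 + ∑' j : ℕ, eulerCoeff Q (j + 1) * (x * Q) ^ (j + 1) := by
      simp only [hF]; rw [(hs _).tsum_eq_zero_add]; simp [h0]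
    have h3 : ∑' j : ℕ, eulerCoeff Q (j + 1) * x ^ (j + 1) -
        ∑' j : ℕ, eulerCoeff Q (j + 1) * (x * Q) ^ (j + 1) = -x * F (x * Q) := by
      rw [← ((summable_nat_add_iff 1).mpr (hs x)).tsum_sub
        ((summable_nat_add_iff 1).mpr (hs (x * Q))), ← tsum_mul_left]
      refine tsum_congr fun j ↦ ?_
      have ha := qPoch_ne_zero_of_norm_lt hQ hQ j
      have hb := qPoch_ne_zero_of_norm_lt hQ hQ (j + 1)
      rw [eulerCoeff, eulerCoeff, Nat.choose_succ_succ' j 1, Nat.choose_one_right]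
      rw [qPoch_succ] at hb ⊢
      have hc := right_ne_zero_of_mul hb
      field_simp
      ring
    linear_combination h1 - h2 + h3
  have hpow : ∀ n : ℕ, F x = qPoch x Q n * F (x * Q ^ n) := by
    intro n
    induction n with
    | zero => simp [qPoch_zero]
    | succ n ih =>
      rw [ih, hrec, qPoch_succ, pow_succ]
      ring_nf
  have h1 := tendsto_tsum_mul_pow_mul_pow hQ (r := 1) (by norm_num)
    (summable_norm_eulerCoeff hQ 1 (by norm_num)) x
  have h2 := (tendsto_qPoch hQ x).mul h1
  have h3 : Tendsto (fun _ : ℕ ↦ F x) atTop (𝓝 (qPochInf x Q * eulerCoeff Q 0)) :=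
    h2.congr fun n ↦ (hpow n).symm
  have h4 := tendsto_nhds_unique tendsto_const_nhds h3
  rw [h0, mul_one] at h4
  rw [← h4]
  exact (hs x).hasSum

/-- Euler's series has infinite radius of convergence. -/
lemma differentiable_qPochInf (hQ : ‖Q‖ < 1) : Differentiable ℂ fun x ↦ qPochInf x Q := by
  intro x
  have h := differentiableOn_tsum_mul_pow
    (summable_norm_eulerCoeff hQ (‖x‖ + 1) (by positivity))
  have heq : (fun x ↦ ∑' j, eulerCoeff Q j * x ^ j) = fun x ↦ qPochInf x Q :=
    funext fun x ↦ (hasSum_qPochInf hQ x).tsum_eq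
  rw [heq] at h
  exact h.differentiableAt (Metric.isOpen_ball.mem_nhds (by simp))

/-- `(x Q ^ n; Q)_∞` is bounded in `n`. -/
lemma exists_norm_qPochInf_mul_pow_le (hQ : ‖Q‖ < 1) (x : ℂ) :
    ∃ M : ℝ, 0 ≤ M ∧ ∀ n : ℕ, ‖qPochInf (x * Q ^ n) Q‖ ≤ M := by
  have ht : Tendsto (fun n : ℕ ↦ x * Q ^ n) atTop (𝓝 0) := by
    simpa using (tendsto_pow_atTop_nhds_zero_of_norm_lt_one hQ).const_mul x
  have h := ((differentiable_qPochInf hQ).continuous.tendsto 0 |>.comp ht).norm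
  obtain ⟨M, hM⟩ := h.bddAbove_range
  exact ⟨M, (norm_nonneg _).trans (hM ⟨0, rfl⟩), fun j ↦ hM ⟨j, rfl⟩⟩

end qPochhammer

lemma HasSum.of_eq {ι : Type*} {f g : ι → ℂ} {a b : ℂ} (h : HasSum f a) (hfg : ∀ i, g i = f i)
    (hab : b = a) : HasSum g b := by
  rw [hab, funext hfg]
  exact h

lemma hasSum_mul_prod {ι ι' : Type*} {f : ι → ℂ} {g : ι' → ℂ} {a b : ℂ} (hf : HasSum f a)
    (hg : HasSum g b) (hf' : Summable fun i ↦ ‖f i‖) (hg' : Summable fun i ↦ ‖g i‖) :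
    HasSum (fun p : ι × ι' ↦ f p.1 * g p.2) (a * b) := by
  have h := summable_mul_of_summable_norm hf' hg'
  rw [← hf.tsum_eq, ← hg.tsum_eq, tsum_mul_tsum_of_summable_norm hf' hg']
  exact h.hasSum

/-! ### Theta functions, the triple product, and bilateral series with a finite factor. -/

section theta

variable {Q : ℂ}

lemma qTheta_mul (hQ : ‖Q‖ < 1) (hQ0 : Q ≠ 0) {x : ℂ} (hx : x ≠ 0) :
    qTheta (x * Q) Q = -x⁻¹ * qTheta x Q := by
  have h1 := qPochInf_eq_one_sub_mul hQ x
  have h2 := qPochInf_eq_one_sub_mul hQ (1 / x)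
  have h3 : Q / (x * Q) = 1 / x := by field_simp
  have h4 : 1 / x * Q = Q / x := by ring
  rw [qTheta, qTheta, h3, h1, h2, h4]
  field_simp
  ring

lemma qTheta_div (hQ : ‖Q‖ < 1) (hQ0 : Q ≠ 0) {x : ℂ} (hx : x ≠ 0) :
    qTheta (x / Q) Q = -(x / Q) * qTheta x Q := by
  have h := qTheta_mul hQ hQ0 (div_ne_zero hx hQ0)
  rw [div_mul_cancel₀ _ hQ0] at h
  rw [h]
  field_simp

lemma qTheta_inv_symm (hQ0 : Q ≠ 0) (x : ℂ) : qTheta (Q / x) Q = qTheta x Q := by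
  rw [qTheta, qTheta, mul_comm, div_div_cancel₀ hQ0]

lemma qTheta_inv (hQ : ‖Q‖ < 1) (hQ0 : Q ≠ 0) {x : ℂ} (hx : x ≠ 0) :
    qTheta x⁻¹ Q = -x⁻¹ * qTheta x Q := by
  rw [← qTheta_mul hQ hQ0 hx, ← qTheta_inv_symm hQ0 (x * Q)]
  congr 1
  field_simp

lemma qTheta_ne_zero (hQ : ‖Q‖ < 1) (hQ0 : Q ≠ 0) {x : ℂ} (hx0 : x ≠ 0)
    (hx : ∀ k : ℤ, x ≠ Q ^ k) : qTheta x Q ≠ 0 := by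
  refine mul_ne_zero (qPochInf_ne_zero hQ fun j h ↦ hx (-j) ?_)
    (qPochInf_ne_zero hQ fun j h ↦ hx (j + 1) ?_)
  · rw [zpow_neg, zpow_natCast]
    exact eq_inv_of_mul_eq_one_left h
  · rw [zpow_add_one₀ hQ0, zpow_natCast]
    field_simp at h
    linear_combination -h

/-- The summand of the bilateral theta series. -/
noncomputable def thetaTerm (Q x : ℂ) (n : ℤ) : ℂ := (-x) ^ n * Q ^ (n * (n - 1) / 2)

lemma triangle_succ (n : ℤ) : (n + 1) * (n + 1 - 1) / 2 = n * (n - 1) / 2 + n := by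
  rw [show (n + 1) * (n + 1 - 1) = n * (n - 1) + n * 2 by ring]
  exact Int.add_mul_ediv_right _ _ (by norm_num)

lemma thetaTerm_add_one (hQ0 : Q ≠ 0) {x : ℂ} (hx : x ≠ 0) (n : ℤ) :
    thetaTerm Q x (n + 1) = -x * Q ^ n * thetaTerm Q x n := by
  rw [thetaTerm, thetaTerm, triangle_succ, zpow_add_one₀ (neg_ne_zero.mpr hx), zpow_add₀ hQ0]
  ring

lemma thetaTerm_zero (Q x : ℂ) : thetaTerm Q x 0 = 1 := by simp [thetaTerm]

lemma thetaTerm_div (x : ℂ) (n : ℤ) :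
    thetaTerm Q (x / Q) n = thetaTerm Q x n * Q ^ (-n) := by
  rw [thetaTerm, thetaTerm, ← neg_div, div_zpow, zpow_neg]
  ring

lemma thetaTerm_natCast (hQ0 : Q ≠ 0) {x : ℂ} (hx : x ≠ 0) (j : ℕ) :
    thetaTerm Q x j = (-x) ^ j * Q ^ j.choose 2 := by
  induction j with
  | zero => simp [thetaTerm_zero]
  | succ j ih =>
    rw [Nat.cast_succ, thetaTerm_add_one hQ0 hx, ih, Nat.choose_succ_succ' j 1,
      Nat.choose_one_right, zpow_natCast]
    ring

lemma thetaTerm_one_sub {x : ℂ} (hx : x ≠ 0) (n : ℤ) :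
    thetaTerm Q x (1 - n) = -x * thetaTerm Q x⁻¹ n := by
  rw [thetaTerm, thetaTerm, show (1 - n) * (1 - n - 1) = n * (n - 1) by ring,
    zpow_sub₀ (neg_ne_zero.mpr hx), zpow_one, ← inv_neg, inv_zpow]
  ring

lemma thetaTerm_neg (hQ0 : Q ≠ 0) {x : ℂ} (hx : x ≠ 0) (n : ℤ) :
    thetaTerm Q x (-n) = thetaTerm Q (Q / x) n := by
  have h1 := thetaTerm_one_sub (Q := Q) hx (n + 1)
  rw [show 1 - (n + 1) = -n by ring, thetaTerm_add_one hQ0 (inv_ne_zero hx)] at h1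
  have h2 := thetaTerm_div (Q := Q) (Q / x) n
  rw [show Q / x / Q = x⁻¹ by field_simp] at h2
  rw [h1, h2, zpow_neg]
  have := zpow_ne_zero n hQ0
  field_simp

lemma summable_norm_thetaTerm (hQ : ‖Q‖ < 1) (hQ0 : Q ≠ 0) {x : ℂ} (hx : x ≠ 0) :
    Summable fun n : ℤ ↦ ‖thetaTerm Q x n‖ := by
  have key : ∀ {x : ℂ}, x ≠ 0 → Summable fun n : ℕ ↦ ‖thetaTerm Q x n‖ := fun {x} hx ↦ by
    simpa only [thetaTerm_natCast hQ0 hx] using (summable_pow_choose_two hQ (-x)).norm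
  refine Summable.of_nat_of_neg (key hx) ?_
  simpa only [thetaTerm_neg hQ0 hx] using key (div_ne_zero hQ0 hx)

lemma eulerCoeff_mul_pow (hQ0 : Q ≠ 0) {x : ℂ} (hx : x ≠ 0) (j : ℕ) :
    eulerCoeff Q j * x ^ j = thetaTerm Q x j * (qPoch Q Q j)⁻¹ := by
  rw [thetaTerm_natCast hQ0 hx, eulerCoeff, neg_pow]
  ring

lemma qPochInf_pow_succ (hQ : ‖Q‖ < 1) (n : ℕ) :
    qPochInf (Q ^ (n + 1)) Q = qPochInf Q Q * (qPoch Q Q n)⁻¹ := by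
  have h := qPochInf_eq_mul hQ Q n
  have h0 := qPoch_ne_zero_of_norm_lt hQ hQ n
  rw [h, pow_succ']
  field_simp

/-- The factor of index `n` is `1 - 1`. This vanishing truncates a bilateral series to a unilateral
one in the proof of the triple product. -/
lemma qPochInf_zpow_of_nonpos (hQ : ‖Q‖ < 1) (hQ0 : Q ≠ 0) (n : ℕ) :
    qPochInf (Q ^ (-(n : ℤ))) Q = 0 := by
  rw [qPochInf_eq_mul hQ _ (n + 1), qPoch_succ, zpow_neg, zpow_natCast,
    inv_mul_cancel₀ (pow_ne_zero _ hQ0)]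
  simp

/-- The triangular exponent at `n + k` splits as those at `n` and `k` plus `nk`. The weight `(Q / z)
^ k` removes the power `z ^ k`, and what is left is a term of Euler's series at `Q ^ (n + 1)`. -/
lemma triangle_add (hQ0 : Q ≠ 0) {z : ℂ} (hz : z ≠ 0) (n : ℤ) (k : ℕ) :
    thetaTerm Q z (n + k) * (Q / z) ^ k =
      thetaTerm Q z n * ((-1) ^ k * Q ^ k.choose 2 * (Q ^ (n + 1)) ^ k) := by
  induction k with
  | zero => simp
  | succ k ih =>
    have h : thetaTerm Q z (n + (k + 1 : ℕ)) = -z * Q ^ (n + k) * thetaTerm Q z (n + k) := by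
      rw [Nat.cast_succ, ← add_assoc, thetaTerm_add_one hQ0 hz]
    rw [zpow_add₀ hQ0 n k, zpow_natCast] at h
    have h2 : thetaTerm Q z (n + (k + 1 : ℕ)) * (Q / z) ^ (k + 1) =
        -(Q ^ n * Q ^ k * Q) * (thetaTerm Q z (n + k) * (Q / z) ^ k) := by
      rw [h, pow_succ (Q / z)]
      field_simp
    rw [h2, ih, Nat.choose_succ_succ' k 1, Nat.choose_one_right, zpow_add_one₀ hQ0]
    ring

/-- The shear `(n, k) ↦ (n + k, k)`. -/
def intAddEquiv : ℤ × ℕ ≃ ℤ × ℕ where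
  toFun p := (p.1 + p.2, p.2)
  invFun p := (p.1 - p.2, p.2)
  left_inv p := by simp
  right_inv p := by simp

lemma hasSum_thetaTerm_add_mul {z b : ℂ} {g : ℕ → ℂ} (hg : HasSum g b)
    (hθ : Summable fun n : ℤ ↦ ‖thetaTerm Q z n‖) (hg' : Summable fun j ↦ ‖g j‖) :
    HasSum (fun p : ℤ × ℕ ↦ thetaTerm Q z (p.1 + p.2) * g p.2)
      ((∑' n, thetaTerm Q z n) * b) :=
  intAddEquiv.hasSum_iff.mpr (hasSum_mul_prod hθ.of_norm.hasSum hg hθ hg')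

/-- Multiply the bilateral series by Euler's expansion of `1 / (Q/z)_∞`, which requires `|Q| < |z|`,
and shear the double sum. The inner sum becomes `(Q ^ (n+1))_∞`, which is zero for `n < 0` and
`(Q)_∞ / (Q)_n` for `n ≥ 0`. Euler's series for `(z)_∞` remains. -/
lemma hasSum_thetaTerm_of_lt (hQ : ‖Q‖ < 1) (hQ0 : Q ≠ 0) {z : ℂ} (hz : ‖Q‖ < ‖z‖) :
    HasSum (thetaTerm Q z) (qPochInf Q Q * qTheta z Q) := by
  have hz0 : z ≠ 0 := norm_pos_iff.mp ((norm_nonneg _).trans_lt hz)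
  have hw : ‖Q / z‖ < 1 := by
    rw [norm_div, div_lt_one ((norm_nonneg _).trans_lt hz)]; exact hz
  have hθ := summable_norm_thetaTerm hQ hQ0 hz0
  have hEs : Summable fun j : ℕ ↦ ‖(qPoch Q Q j)⁻¹ * (Q / z) ^ j‖ := by
    simpa using summable_norm_pow_div_qPoch hQ (norm_nonneg _) hw
  have h1 := hasSum_thetaTerm_add_mul (hasSum_inv_qPochInf hQ hw) hθ hEs
  have hfib : ∀ n : ℤ, HasSum (fun k : ℕ ↦ thetaTerm Q z (n + k) *
      ((qPoch Q Q k)⁻¹ * (Q / z) ^ k)) (thetaTerm Q z n * qPochInf (Q ^ (n + 1)) Q) := by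
    intro n
    refine ((hasSum_qPochInf hQ (Q ^ (n + 1))).mul_left (thetaTerm Q z n)).of_eq (fun k ↦ ?_) rfl
    rw [eulerCoeff]
    linear_combination (qPoch Q Q k)⁻¹ * triangle_add hQ0 hz0 n k
  have h2 : HasSum (fun n : ℤ ↦ thetaTerm Q z n * qPochInf (Q ^ (n + 1)) Q)
      ((∑' n, thetaTerm Q z n) * (qPochInf (Q / z) Q)⁻¹) := HasSum.prod_fiberwise h1 hfib
  have h3 : HasSum (fun n : ℤ ↦ thetaTerm Q z n * qPochInf (Q ^ (n + 1)) Q)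
      (qPochInf Q Q * qPochInf z Q + 0) := by
    refine HasSum.of_nat_of_neg_add_one ?_ ?_
    · refine ((hasSum_qPochInf hQ z).mul_left (qPochInf Q Q)).of_eq (fun j ↦ ?_) rfl
      rw [eulerCoeff_mul_pow hQ0 hz0]
      have := qPochInf_pow_succ hQ j
      rw [show ((j : ℤ) + 1) = ((j + 1 : ℕ) : ℤ) by push_cast; rfl, zpow_natCast, this]
      ring
    · refine hasSum_zero.of_eq (fun j ↦ ?_) rfl
      rw [show -((j : ℤ) + 1) + 1 = -(j : ℤ) by ring, qPochInf_zpow_of_nonpos hQ hQ0, mul_zero]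
  have h4 := h3.unique h2
  have h5 := qPochInf_ne_zero_of_norm_lt hQ hw
  have h6 : qPochInf Q Q * qTheta z Q = ∑' n, thetaTerm Q z n := by
    rw [qTheta]
    field_simp at h4
    linear_combination h4
  rw [h6]
  exact hθ.of_norm.hasSum

/-- The Jacobi triple product identity. -/
theorem hasSum_thetaTerm (hQ : ‖Q‖ < 1) (hQ0 : Q ≠ 0) {z : ℂ} (hz : z ≠ 0) :
    HasSum (thetaTerm Q z) (qPochInf Q Q * qTheta z Q) := by
  have hstep : ∀ {w : ℂ}, w ≠ 0 → HasSum (thetaTerm Q w) (qPochInf Q Q * qTheta w Q) →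
      HasSum (thetaTerm Q (w * Q)) (qPochInf Q Q * qTheta (w * Q) Q) := by
    intro w hw h
    have h1 := ((Equiv.addRight (1 : ℤ)).hasSum_iff.mpr h).mul_left (-w⁻¹)
    rw [qTheta_mul hQ hQ0 hw]
    refine h1.of_eq (fun n ↦ ?_) (by ring)
    · have h2 := thetaTerm_div (Q := Q) (w * Q) n
      rw [mul_div_cancel_right₀ _ hQ0, zpow_neg] at h2
      have h3 := thetaTerm_add_one hQ0 hw n
      have h4 := zpow_ne_zero n hQ0
      simp only [Function.comp, Equiv.coe_addRight]
      rw [h3, h2]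
      field_simp
  have hpow : ∀ (n : ℕ) {w : ℂ}, w ≠ 0 → HasSum (thetaTerm Q w) (qPochInf Q Q * qTheta w Q) →
      HasSum (thetaTerm Q (w * Q ^ n)) (qPochInf Q Q * qTheta (w * Q ^ n) Q) := by
    intro n w hw h
    induction n with
    | zero => simpa using h
    | succ n ih =>
      rw [pow_succ, ← mul_assoc]
      exact hstep (mul_ne_zero hw (pow_ne_zero _ hQ0)) ih
  -- Dividing `z` by a high power of `Q` makes its norm exceed `1`, hence `‖Q‖`; quasi-periodicity
  -- then leads back to `z`.
  obtain ⟨n, hn⟩ := exists_pow_lt_of_lt_one (norm_pos_iff.mpr hz) hQ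
  have hzn : z = z / Q ^ n * Q ^ n := by field_simp
  rw [hzn]
  refine hpow n (div_ne_zero hz (pow_ne_zero _ hQ0)) (hasSum_thetaTerm_of_lt hQ hQ0 ?_)
  rw [norm_div, norm_pow]
  refine hQ.trans ?_
  rwa [one_lt_div (pow_pos (norm_pos_iff.mpr hQ0) _)]

/-- The summand of the bilateral series `∑ (-z/κ) ^ n Q ^ (n(n-1)/2) (κ Q ^ (1-n); Q)_p`. -/
noncomputable def thetaPochTerm (Q : ℂ) (p : ℕ) (κ z : ℂ) (n : ℤ) : ℂ :=
  thetaTerm Q (z / κ) n * qPoch (κ * Q ^ (1 - n)) Q p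

/-- The new factor is `1 - κ Q ^ (p+1) Q ^ (-n)`, and `Q ^ (-n)` is absorbed by `z ↦ z / Q`. -/
lemma thetaPochTerm_succ (hQ0 : Q ≠ 0) (p : ℕ) (κ z : ℂ) (n : ℤ) :
    thetaPochTerm Q (p + 1) κ z n =
      thetaPochTerm Q p κ z n - κ * Q ^ (p + 1) * thetaPochTerm Q p κ (z / Q) n := by
  rw [thetaPochTerm, thetaPochTerm, thetaPochTerm, qPoch_succ, div_right_comm, thetaTerm_div,
    sub_eq_add_neg 1 n, zpow_add₀ hQ0, zpow_one]
  ring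

lemma summable_norm_thetaPochTerm (hQ : ‖Q‖ < 1) (hQ0 : Q ≠ 0) (p : ℕ) {κ z : ℂ} (hκ : κ ≠ 0)
    (hz : z ≠ 0) : Summable fun n ↦ ‖thetaPochTerm Q p κ z n‖ := by
  induction p generalizing z with
  | zero =>
    simpa [thetaPochTerm, qPoch_zero] using summable_norm_thetaTerm hQ hQ0 (div_ne_zero hz hκ)
  | succ p ih =>
    simp only [thetaPochTerm_succ hQ0]
    refine Summable.of_nonneg_of_le (fun n ↦ norm_nonneg _) (fun n ↦ norm_sub_le _ _)
      ((ih hz).add ?_)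
    simp only [norm_mul]
    exact (ih (div_ne_zero hz hQ0)).mul_left _

/-- The bilateral series `∑ (-z/κ) ^ n Q ^ (n(n-1)/2) (κ Q ^ (1-n); Q)_p`. -/
noncomputable def thetaPoch (Q : ℂ) (p : ℕ) (κ z : ℂ) : ℂ := ∑' n : ℤ, thetaPochTerm Q p κ z n

lemma thetaPoch_succ (hQ : ‖Q‖ < 1) (hQ0 : Q ≠ 0) (p : ℕ) {κ z : ℂ} (hκ : κ ≠ 0) (hz : z ≠ 0) :
    thetaPoch Q (p + 1) κ z =
      thetaPoch Q p κ z - κ * Q ^ (p + 1) * thetaPoch Q p κ (z / Q) := by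
  have h1 := (summable_norm_thetaPochTerm hQ hQ0 p hκ hz).of_norm
  have h2 := (summable_norm_thetaPochTerm hQ hQ0 p hκ (div_ne_zero hz hQ0)).of_norm
  simp only [thetaPoch]
  rw [← tsum_mul_left, ← h1.tsum_sub (h2.mul_left _)]
  exact tsum_congr fun n ↦ thetaPochTerm_succ hQ0 p κ z n

lemma thetaPoch_zero (hQ : ‖Q‖ < 1) (hQ0 : Q ≠ 0) {κ z : ℂ} (hκ : κ ≠ 0) (hz : z ≠ 0) :
    thetaPoch Q 0 κ z = qPochInf Q Q * qTheta (z / κ) Q := by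
  simpa [thetaPoch, thetaPochTerm, qPoch_zero] using
    (hasSum_thetaTerm hQ hQ0 (div_ne_zero hz hκ)).tsum_eq

/-- Induction on `p`: under `z ↦ z / Q` the ratio `θ(z/κ) / θ(z)` gains a factor `1/κ`, which
cancels the `κ` in the recursion of `thetaPoch`. -/
lemma qTheta_mul_thetaPoch (hQ : ‖Q‖ < 1) (hQ0 : Q ≠ 0) (p : ℕ) {κ z : ℂ} (hκ : κ ≠ 0)
    (hz : z ≠ 0) :
    qTheta z Q * thetaPoch Q p κ z = qTheta (z / κ) Q * thetaPoch Q p 1 z := by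
  induction p generalizing z with
  | zero =>
    rw [thetaPoch_zero hQ hQ0 hκ hz, thetaPoch_zero hQ hQ0 one_ne_zero hz, div_one]
    ring
  | succ p ih =>
    have h1 := ih hz
    have h2 := ih (div_ne_zero hz hQ0)
    rw [div_right_comm, qTheta_div hQ hQ0 hz, qTheta_div hQ hQ0 (div_ne_zero hz hκ)] at h2
    rw [thetaPoch_succ hQ hQ0 p hκ hz, thetaPoch_succ hQ hQ0 p one_ne_zero hz]
    have h3 : qTheta z Q * thetaPoch Q p κ (z / Q) =
        qTheta (z / κ) Q * thetaPoch Q p 1 (z / Q) / κ := by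
      have : z / Q ≠ 0 := div_ne_zero hz hQ0
      apply mul_left_cancel₀ (neg_ne_zero.mpr this)
      rw [← mul_assoc, h2]
      field_simp
    have h4 : κ * (qTheta z Q * thetaPoch Q p κ (z / Q)) =
        qTheta (z / κ) Q * thetaPoch Q p 1 (z / Q) := by rw [h3]; field_simp
    linear_combination h1 - Q ^ (p + 1) * h4

end theta

/-! ### The case `κ = 1`: splitting into two unilateral series. -/

section thetaPochOne

variable {Q : ℂ}

/-- The summand of the unilateral series `∑ Q ^ (k(p+1)) (x Q ^ (k+1); Q)_∞ / (Q; Q)_k`. -/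
noncomputable def tailTerm (Q : ℂ) (p : ℕ) (x : ℂ) (k : ℕ) : ℂ :=
  (qPoch Q Q k)⁻¹ * (Q ^ (p + 1)) ^ k * qPochInf (x * Q * Q ^ k) Q

lemma summable_norm_tailTerm (hQ : ‖Q‖ < 1) (p : ℕ) (x : ℂ) :
    Summable fun k ↦ ‖tailTerm Q p x k‖ := by
  obtain ⟨M, hM0, hM⟩ := exists_norm_qPochInf_mul_pow_le hQ (x * Q)
  have hQp : ‖Q‖ ^ (p + 1) < 1 := pow_lt_one₀ (norm_nonneg _) hQ (by omega)
  refine Summable.of_nonneg_of_le (fun k ↦ norm_nonneg _) (fun k ↦ ?_)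
    ((summable_norm_pow_div_qPoch hQ (by positivity) hQp).mul_right M)
  rw [tailTerm, norm_mul, norm_mul, norm_pow, norm_pow]
  gcongr
  exact hM k

/-- The series `∑ Q ^ (k(p+1)) (x Q ^ (k+1); Q)_∞ / (Q; Q)_k`. -/
noncomputable def tailSum (Q : ℂ) (p : ℕ) (x : ℂ) : ℂ := ∑' k, tailTerm Q p x k

/-- The difference produces a factor `1 - Q ^ k`, which kills `k = 0` and cancels the last factor of
`(Q; Q)_k`; then shift `k`. -/
lemma tailSum_sub_tailSum_succ (hQ : ‖Q‖ < 1) (p : ℕ) (x : ℂ) :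
    tailSum Q p x - tailSum Q (p + 1) x = Q ^ (p + 1) * tailSum Q p (x * Q) := by
  have h1 := (summable_norm_tailTerm hQ p x).of_norm
  have h2 := (summable_norm_tailTerm hQ (p + 1) x).of_norm
  rw [tailSum, tailSum, tailSum, h1.tsum_eq_zero_add, h2.tsum_eq_zero_add, ← tsum_mul_left]
  have h0 : tailTerm Q p x 0 = tailTerm Q (p + 1) x 0 := by simp [tailTerm]
  rw [h0, add_sub_add_left_eq_sub, ← ((summable_nat_add_iff 1).mpr h1).tsum_sub
    ((summable_nat_add_iff 1).mpr h2)]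
  refine tsum_congr fun k ↦ ?_
  have hb := qPoch_ne_zero_of_norm_lt hQ hQ (k + 1)
  simp only [tailTerm]
  rw [qPoch_succ] at hb ⊢
  have ha := left_ne_zero_of_mul hb
  have hc := right_ne_zero_of_mul hb
  rw [show x * Q * Q ^ (k + 1) = x * Q * Q * Q ^ k by ring]
  field_simp
  ring

/-- Termwise this is `(x Q ^ k)_∞ = (1 - x Q ^ k) (x Q ^ (k+1))_∞`. -/
lemma mul_tailSum_succ (hQ : ‖Q‖ < 1) (hQ0 : Q ≠ 0) (p : ℕ) (x : ℂ) :
    x * tailSum Q (p + 1) x = tailSum Q p x - tailSum Q p (x / Q) := by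
  have h1 := (summable_norm_tailTerm hQ p x).of_norm
  have h2 := (summable_norm_tailTerm hQ p (x / Q)).of_norm
  rw [tailSum, tailSum, tailSum, ← tsum_mul_left, ← h1.tsum_sub h2]
  refine tsum_congr fun k ↦ ?_
  simp only [tailTerm]
  rw [div_mul_cancel₀ _ hQ0, qPochInf_eq_one_sub_mul hQ (x * Q ^ k),
    show x * Q * Q ^ k = x * Q ^ k * Q by ring]
  ring

lemma summable_eulerCoeff_mul_tail (hQ : ‖Q‖ < 1) (x : ℂ) :
    Summable fun p : ℕ × ℕ ↦ eulerCoeff Q p.1 * (x * Q) ^ p.1 *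
      ((qPoch Q Q p.2)⁻¹ * (Q ^ (p.1 + 1)) ^ p.2) := by
  have h := (summable_norm_eulerCoeff_mul_pow hQ (x * Q)).mul_of_nonneg
    (summable_norm_pow_div_qPoch hQ (norm_nonneg Q) hQ) (fun _ ↦ norm_nonneg _)
    (fun _ ↦ by positivity)
  refine Summable.of_norm_bounded h fun p ↦ ?_
  rw [norm_mul, norm_mul (qPoch Q Q p.2)⁻¹, norm_pow, norm_pow]
  gcongr
  exact pow_le_of_le_one (norm_nonneg _) hQ.le (by omega)

/-- A partial theta series is Euler's series for `(xQ)_∞` with an extra `(Q)_j = (Q)_∞ / (Q ^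
(j+1))_∞`. Expanding this reciprocal in `k` and summing over `j` first gives `(x Q ^ (k+1))_∞`. -/
lemma hasSum_thetaTerm_nat (hQ : ‖Q‖ < 1) (hQ0 : Q ≠ 0) {x : ℂ} (hx : x ≠ 0) :
    HasSum (fun j : ℕ ↦ thetaTerm Q (x * Q) j) (qPochInf Q Q * tailSum Q 0 x) := by
  have hsum := (summable_eulerCoeff_mul_tail hQ x).hasSum
  have hj : ∀ j : ℕ, HasSum (fun k : ℕ ↦ eulerCoeff Q j * (x * Q) ^ j *
      ((qPoch Q Q k)⁻¹ * (Q ^ (j + 1)) ^ k))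
      (thetaTerm Q (x * Q) j * (qPochInf Q Q)⁻¹) := by
    intro j
    have hlt : ‖Q ^ (j + 1)‖ < 1 := by
      rw [norm_pow]; exact pow_lt_one₀ (norm_nonneg _) hQ (by omega)
    refine ((hasSum_inv_qPochInf hQ hlt).mul_left _).of_eq (fun _ ↦ rfl) ?_
    have h0 := qPoch_ne_zero_of_norm_lt hQ hQ j
    have h1 := qPochInf_ne_zero_of_norm_lt hQ hQ
    rw [qPochInf_pow_succ hQ, eulerCoeff_mul_pow hQ0 (mul_ne_zero hx hQ0)]
    field_simp
  have hk : ∀ k : ℕ, HasSum (fun j : ℕ ↦ eulerCoeff Q j * (x * Q) ^ j *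
      ((qPoch Q Q k)⁻¹ * (Q ^ (j + 1)) ^ k)) (tailTerm Q 0 x k) := by
    intro k
    refine ((hasSum_qPochInf hQ (x * Q * Q ^ k)).mul_left
      ((qPoch Q Q k)⁻¹ * Q ^ k)).of_eq (fun j ↦ ?_) (by simp [tailTerm])
    rw [mul_pow (x * Q) (Q ^ k), ← pow_mul, ← pow_mul]
    ring
  have h1 := hsum.prod_fiberwise hj
  have h2 := HasSum.prod_fiberwise ((Equiv.prodComm ℕ ℕ).hasSum_iff.mpr hsum) hk
  have h3 := h1.mul_left (qPochInf Q Q)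
  rw [← h2.tsum_eq] at h3
  have h0 := qPochInf_ne_zero_of_norm_lt hQ hQ
  exact h3.of_eq (fun j ↦ by field_simp) rfl

/-- The triple product is cut into its parts `n ≤ 0` and `n > 0`, each a partial theta series. -/
lemma tailSum_zero_sub (hQ : ‖Q‖ < 1) (hQ0 : Q ≠ 0) {z : ℂ} (hz : z ≠ 0) :
    tailSum Q 0 z⁻¹ - z * tailSum Q 0 z = qTheta z Q := by
  have h1 := hasSum_thetaTerm_nat hQ hQ0 (inv_ne_zero hz)
  have h2 := (hasSum_thetaTerm_nat hQ hQ0 hz).mul_left (-z)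
  have h3 : HasSum (fun n : ℤ ↦ thetaTerm Q z (-n)) (qPochInf Q Q * tailSum Q 0 z⁻¹ +
      -z * (qPochInf Q Q * tailSum Q 0 z)) := by
    refine HasSum.of_nat_of_neg_add_one (h1.of_eq (fun j ↦ ?_) rfl) (h2.of_eq (fun j ↦ ?_) rfl)
    · rw [thetaTerm_neg hQ0 hz, div_eq_inv_mul]
    · have h := thetaTerm_div (Q := Q) (z * Q) j
      rw [mul_div_cancel_right₀ _ hQ0, zpow_neg] at h
      rw [neg_neg, thetaTerm_add_one hQ0 hz, h]
      have := zpow_ne_zero (j : ℤ) hQ0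
      field_simp
  have h4 : HasSum (fun n : ℤ ↦ thetaTerm Q z (-n)) (qPochInf Q Q * qTheta z Q) :=
    (Equiv.neg ℤ).hasSum_iff.mpr (hasSum_thetaTerm hQ hQ0 hz)
  refine mul_left_cancel₀ (qPochInf_ne_zero_of_norm_lt hQ hQ) ?_
  rw [h4.unique h3]
  ring

/-- At `κ = 1` the terms with `1 ≤ n ≤ p` vanish, which explains the two tails. The proof is by
induction: the two contiguous relations of `tailSum` make the right side satisfy the recursion of
`thetaPoch`. -/
lemma thetaPoch_one (hQ : ‖Q‖ < 1) (hQ0 : Q ≠ 0) (p : ℕ) {z : ℂ} (hz : z ≠ 0) :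
    thetaPoch Q p 1 z =
      qPochInf Q Q * (tailSum Q p z⁻¹ - z ^ (p + 1) * tailSum Q p z) := by
  induction p generalizing z with
  | zero =>
    rw [thetaPoch_zero hQ hQ0 one_ne_zero hz, div_one, ← tailSum_zero_sub hQ hQ0 hz]
    ring
  | succ p ih =>
    rw [thetaPoch_succ hQ hQ0 p one_ne_zero hz, ih hz, ih (div_ne_zero hz hQ0), inv_div]
    have h1 := tailSum_sub_tailSum_succ hQ p z⁻¹
    have h2 := mul_tailSum_succ hQ hQ0 p z
    have h3 : Q ^ (p + 1) * (z / Q) ^ (p + 1) = z ^ (p + 1) := by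
      rw [← mul_pow, mul_div_cancel₀ _ hQ0]
    rw [show Q / z = z⁻¹ * Q by ring]
    linear_combination qPochInf Q Q * h1 + qPochInf Q Q * z ^ (p + 1) * h2 +
      qPochInf Q Q * tailSum Q p (z / Q) * h3

end thetaPochOne

/-! ### Analytic continuation of `₂φ₁`. -/

section phi21

variable {Q : ℂ}

/-- The Taylor coefficients of `(Cx; Q)_∞ / ((Ax; Q)_∞ (Bx; Q)_∞)`. -/
noncomputable def ratioCoeff (A B C Q : ℂ) (m : ℕ) : ℂ :=
  ((m.factorial : ℂ))⁻¹ * iteratedDeriv m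
    (fun x ↦ qPochInf (C * x) Q / (qPochInf (A * x) Q * qPochInf (B * x) Q)) 0

lemma hasSum_ratioCoeff (hQ : ‖Q‖ < 1) {A B : ℂ} (C : ℂ) {ρ : ℝ} (hA : ‖A‖ ≤ ρ) (hB : ‖B‖ ≤ ρ)
    {x : ℂ} (hx : ‖x‖ * ρ < 1) :
    HasSum (fun m ↦ ratioCoeff A B C Q m * x ^ m)
      (qPochInf (C * x) Q / (qPochInf (A * x) Q * qPochInf (B * x) Q)) := by
  have hρ0 : 0 ≤ ρ := (norm_nonneg _).trans hA
  -- A disc strictly containing `x` on which the denominator has no zero; for `ρ = 0` any radius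
  -- will do.
  obtain ⟨r, hr, hrρ⟩ : ∃ r : ℝ, ‖x‖ < r ∧ r * ρ < 1 := by
    rcases hρ0.eq_or_lt with h | h
    · exact ⟨‖x‖ + 1, by linarith, by simp [← h]⟩
    · obtain ⟨r, h1, h2⟩ := exists_between ((lt_div_iff₀ h).mpr hx)
      exact ⟨r, h1, (lt_div_iff₀ h).mp h2⟩
  have hd := differentiable_qPochInf hQ
  have hlt : ∀ {D y : ℂ}, ‖D‖ ≤ ρ → y ∈ Metric.ball (0 : ℂ) r → qPochInf (D * y) Q ≠ 0 := by
    intro D y hD hy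
    refine qPochInf_ne_zero_of_norm_lt hQ ?_
    rw [norm_mul]
    have := mem_ball_zero_iff.mp hy
    calc ‖D‖ * ‖y‖ ≤ ρ * r := by gcongr
      _ < 1 := by linarith
  have hc : ∀ D : ℂ, Differentiable ℂ fun y ↦ qPochInf (D * y) Q := fun D ↦
    hd.comp (differentiable_id.const_mul D)
  have hdiff : DifferentiableOn ℂ
      (fun x ↦ qPochInf (C * x) Q / (qPochInf (A * x) Q * qPochInf (B * x) Q))
      (Metric.ball 0 r) :=
    (hc C).differentiableOn.div ((hc A).differentiableOn.mul (hc B).differentiableOn)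
      fun y hy ↦ mul_ne_zero (hlt hA hy) (hlt hB hy)
  refine (Complex.hasSum_taylorSeries_on_ball hdiff (mem_ball_zero_iff.mpr hr)).of_eq
    (fun m ↦ ?_) rfl
  simp only [ratioCoeff, smul_eq_mul, sub_zero]
  ring

lemma mem_phi21Domain_iff (hQ : ‖Q‖ < 1) {w : ℂ} : w ∈ phi21Domain Q ↔ qPochInf w Q ≠ 0 := by
  refine ⟨fun h ↦ qPochInf_ne_zero hQ h, fun h k hk ↦ h ?_⟩
  rw [qPochInf_eq_mul hQ w (k + 1), qPoch_succ, hk]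
  simp

lemma isOpen_phi21Domain (hQ : ‖Q‖ < 1) : IsOpen (phi21Domain Q) := by
  have : phi21Domain Q = (fun w ↦ qPochInf w Q) ⁻¹' {0}ᶜ := by
    ext w; simp [mem_phi21Domain_iff hQ]
  rw [this]
  exact isOpen_compl_singleton.preimage (differentiable_qPochInf hQ).continuous

/-- The complement of a countable set in the plane is connected. -/
lemma isPreconnected_phi21Domain : IsPreconnected (phi21Domain Q) := by
  have hc : (Set.range fun k : ℕ ↦ (Q ^ k)⁻¹).Countable := Set.countable_range _
  have hsub : (phi21Domain Q)ᶜ ⊆ Set.range fun k : ℕ ↦ (Q ^ k)⁻¹ := by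
    intro w hw
    simp only [phi21Domain, Set.mem_compl_iff, Set.mem_ofPred_eq, not_forall, not_not] at hw
    obtain ⟨k, hk⟩ := hw
    exact ⟨k, (eq_inv_of_mul_eq_one_left hk).symm⟩
  have := (hc.mono hsub).isConnected_compl_of_one_lt_rank (by simp)
  rw [compl_compl] at this
  exact this.isPreconnected

lemma ball_subset_phi21Domain (hQ : ‖Q‖ < 1) : Metric.ball 0 1 ⊆ phi21Domain Q := fun _ hw ↦
  mul_pow_ne_one hQ (mem_ball_zero_iff.mp hw)

lemma mul_pow_mem_phi21Domain {w : ℂ} (hw : w ∈ phi21Domain Q) (m : ℕ) :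
    w * Q ^ m ∈ phi21Domain Q := by
  intro k h
  refine hw (m + k) ?_
  rw [pow_add, ← mul_assoc, h]

lemma norm_qPoch_le (hQ : ‖Q‖ < 1) (w : ℂ) (m : ℕ) :
    ‖qPoch w Q m‖ ≤ Real.exp (‖w‖ / (1 - ‖Q‖)) := by
  rw [qPoch, norm_prod]
  calc ∏ j ∈ Finset.range m, ‖1 - w * Q ^ j‖
      ≤ ∏ j ∈ Finset.range m, (1 + ‖w‖ * ‖Q‖ ^ j) := by
        refine Finset.prod_le_prod (fun _ _ ↦ norm_nonneg _) fun j _ ↦ ?_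
        refine (norm_sub_le _ _).trans ?_
        rw [norm_one, norm_mul, norm_pow]
    _ ≤ Real.exp (∑ j ∈ Finset.range m, ‖w‖ * ‖Q‖ ^ j) :=
        Real.prod_one_add_le_exp_sum _ fun _ ↦ by positivity
    _ ≤ _ := by
        refine Real.exp_le_exp.mpr ?_
        have hs := (hasSum_geometric_of_lt_one (norm_nonneg Q) hQ).mul_left ‖w‖
        rw [div_eq_mul_inv]
        exact sum_le_hasSum _ (fun _ _ ↦ by positivity) hs

/-- All poles go into the common factor `1 / (w)_∞`. The polynomials left over are bounded uniformly
in `m` by `norm_qPoch_le`, so summability of the coefficients alone gives convergence and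
holomorphy. -/
lemma inv_qPochInf_mul_pow (hQ : ‖Q‖ < 1) {w : ℂ} (hw : w ∈ phi21Domain Q) (m : ℕ) :
    (qPochInf (w * Q ^ m) Q)⁻¹ = qPoch w Q m * (qPochInf w Q)⁻¹ := by
  have h := qPochInf_eq_mul hQ w m
  have h0 : qPoch w Q m ≠ 0 := qPoch_ne_zero hw m
  rw [h]
  have := qPochInf_ne_zero hQ (mul_pow_mem_phi21Domain hw m)
  field_simp

lemma summable_mul_inv_qPochInf (hQ : ‖Q‖ < 1) {e : ℕ → ℂ} (he : Summable fun m ↦ ‖e m‖) {w : ℂ}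
    (hw : w ∈ phi21Domain Q) : Summable fun m ↦ ‖e m * (qPochInf (w * Q ^ m) Q)⁻¹‖ := by
  refine Summable.of_nonneg_of_le (fun _ ↦ norm_nonneg _) (fun m ↦ ?_)
    (he.mul_right (Real.exp (‖w‖ / (1 - ‖Q‖)) * ‖(qPochInf w Q)⁻¹‖))
  rw [inv_qPochInf_mul_pow hQ hw, norm_mul, norm_mul]
  gcongr
  exact norm_qPoch_le hQ w m

lemma differentiableOn_tsum_mul_inv_qPochInf (hQ : ‖Q‖ < 1) {e : ℕ → ℂ}
    (he : Summable fun m ↦ ‖e m‖) :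
    DifferentiableOn ℂ (fun w ↦ ∑' m, e m * (qPochInf (w * Q ^ m) Q)⁻¹) (phi21Domain Q) := by
  have h1 : Differentiable ℂ fun w ↦ ∑' m, e m * qPoch w Q m := by
    intro w
    have hd : DifferentiableOn ℂ (fun w ↦ ∑' m, e m * qPoch w Q m)
        (Metric.ball 0 (‖w‖ + 1)) := by
      refine Complex.differentiableOn_tsum_of_summable_norm
        (he.mul_right (Real.exp ((‖w‖ + 1) / (1 - ‖Q‖)))) (fun m ↦ ?_) Metric.isOpen_ball
        fun m v hv ↦ ?_
      · unfold qPoch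
        fun_prop
      · rw [norm_mul]
        gcongr
        refine (norm_qPoch_le hQ v m).trans (Real.exp_le_exp.mpr ?_)
        have := (mem_ball_zero_iff.mp hv).le
        have : 0 < 1 - ‖Q‖ := by linarith
        gcongr
    exact hd.differentiableAt (Metric.isOpen_ball.mem_nhds (by simp))
  refine (h1.differentiableOn.mul ((differentiable_qPochInf hQ).differentiableOn.inv
    fun w hw ↦ (mem_phi21Domain_iff hQ).mp hw)).congr fun w hw ↦ ?_
  simp only [Pi.mul_apply, Pi.inv_apply]
  rw [← tsum_mul_right]
  refine tsum_congr fun m ↦ ?_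
  rw [inv_qPochInf_mul_pow hQ hw, mul_assoc]

lemma qPochInf_mul_pow_eq_div (hQ : ‖Q‖ < 1) {x : ℂ} {n : ℕ} (hx : qPoch x Q n ≠ 0) :
    qPochInf (x * Q ^ n) Q = qPochInf x Q / qPoch x Q n := by
  rw [qPochInf_eq_mul hQ x n]
  field_simp

/-- Expand `(C Q ^ j)_∞ / ((A Q ^ j)_∞ (B Q ^ j)_∞)` in powers of `Q ^ j` and sum over `j` with
Euler's formula at `w Q ^ m`. The bound `ρ < 1` places `x = 1`, and so every `Q ^ j`, inside the
disc of convergence. -/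
lemma phi21Series_eq (hQ : ‖Q‖ < 1) {A B C : ℂ} {ρ : ℝ} (hA : ‖A‖ ≤ ρ) (hB : ‖B‖ ≤ ρ)
    (hρ : ρ < 1) (hC : ‖C‖ < 1) {w : ℂ} (hw : ‖w‖ < 1) :
    phi21Series A B C Q w = qPochInf A Q * qPochInf B Q / qPochInf C Q *
      ∑' m, ratioCoeff A B C Q m * (qPochInf (w * Q ^ m) Q)⁻¹ := by
  have hρ0 : 0 ≤ ρ := (norm_nonneg _).trans hA
  have he : Summable fun m ↦ ‖ratioCoeff A B C Q m‖ := by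
    simpa using (hasSum_ratioCoeff hQ C hA hB (x := 1) (by simpa using hρ)).summable.norm
  have hsum : Summable fun p : ℕ × ℕ ↦
      ratioCoeff A B C Q p.1 * ((qPoch Q Q p.2)⁻¹ * (w * Q ^ p.1) ^ p.2) := by
    refine Summable.of_norm_bounded (he.mul_of_nonneg
      (summable_norm_pow_div_qPoch hQ (norm_nonneg w) hw) (fun _ ↦ norm_nonneg _)
      (fun _ ↦ by positivity)) fun p ↦ ?_
    rw [norm_mul, norm_mul (qPoch Q Q p.2)⁻¹, norm_pow, norm_mul, norm_pow]
    gcongr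
    exact mul_le_of_le_one_right (norm_nonneg _) (pow_le_one₀ (norm_nonneg _) hQ.le)
  have hm : ∀ m : ℕ, HasSum (fun j : ℕ ↦
      ratioCoeff A B C Q m * ((qPoch Q Q j)⁻¹ * (w * Q ^ m) ^ j))
      (ratioCoeff A B C Q m * (qPochInf (w * Q ^ m) Q)⁻¹) := fun m ↦ by
    refine (hasSum_inv_qPochInf hQ ?_).mul_left _
    rw [norm_mul, norm_pow]
    exact (mul_le_of_le_one_right (norm_nonneg _) (pow_le_one₀ (norm_nonneg _) hQ.le)).trans_lt hw
  have hj : ∀ j : ℕ, HasSum (fun m : ℕ ↦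
      ratioCoeff A B C Q m * ((qPoch Q Q j)⁻¹ * (w * Q ^ m) ^ j))
      (qPochInf (C * Q ^ j) Q / (qPochInf (A * Q ^ j) Q * qPochInf (B * Q ^ j) Q) *
        ((qPoch Q Q j)⁻¹ * w ^ j)) := fun j ↦ by
    refine ((hasSum_ratioCoeff hQ C hA hB (x := Q ^ j) ?_).mul_right
      ((qPoch Q Q j)⁻¹ * w ^ j)).of_eq (fun m ↦ ?_) rfl
    · rw [norm_pow]
      exact (mul_le_of_le_one_left hρ0 (pow_le_one₀ (norm_nonneg _) hQ.le)).trans_lt hρ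
    · rw [mul_pow, ← pow_mul, ← pow_mul, mul_comm m j]
      ring
  have h1 := hsum.hasSum.prod_fiberwise hm
  have h2 := HasSum.prod_fiberwise ((Equiv.prodComm ℕ ℕ).hasSum_iff.mpr hsum.hasSum) hj
  rw [h1.tsum_eq, ← h2.tsum_eq, phi21Series, ← tsum_mul_left]
  refine tsum_congr fun j ↦ ?_
  have hA1 := hA.trans_lt hρ
  have hB1 := hB.trans_lt hρ
  have a1 := qPoch_ne_zero_of_norm_lt hQ hA1 j
  have a2 := qPoch_ne_zero_of_norm_lt hQ hB1 j
  have a3 := qPoch_ne_zero_of_norm_lt hQ hC j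
  have b1 := qPochInf_ne_zero_of_norm_lt hQ hA1
  have b2 := qPochInf_ne_zero_of_norm_lt hQ hB1
  have b3 := qPochInf_ne_zero_of_norm_lt hQ hC
  have b4 := qPoch_ne_zero_of_norm_lt hQ hQ j
  rw [qPochInf_mul_pow_eq_div hQ a1, qPochInf_mul_pow_eq_div hQ a2, qPochInf_mul_pow_eq_div hQ a3]
  field_simp

/-- The analytic continuation of `₂φ₁` as a series in `1 / (w Q ^ m; Q)_∞`. -/
theorem phi21_eq (hQ : ‖Q‖ < 1) {A B C : ℂ} {ρ : ℝ} (hA : ‖A‖ ≤ ρ) (hB : ‖B‖ ≤ ρ)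
    (hρ : ρ < 1) (hC : ‖C‖ < 1) {w : ℂ} (hw : w ∈ phi21Domain Q) :
    phi21 A B C Q w = qPochInf A Q * qPochInf B Q / qPochInf C Q *
      ∑' m, ratioCoeff A B C Q m * (qPochInf (w * Q ^ m) Q)⁻¹ := by
  have he : Summable fun m ↦ ‖ratioCoeff A B C Q m‖ := by
    simpa using (hasSum_ratioCoeff hQ C hA hB (x := 1) (by simpa using hρ)).summable.norm
  set F : ℂ → ℂ := fun w ↦ qPochInf A Q * qPochInf B Q / qPochInf C Q *
      ∑' m, ratioCoeff A B C Q m * (qPochInf (w * Q ^ m) Q)⁻¹ with hF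
  have hFc : IsPhi21Continuation A B C Q F :=
    ⟨(differentiableOn_tsum_mul_inv_qPochInf hQ he).const_mul _,
      fun w hw ↦ (phi21Series_eq hQ hA hB hρ hC hw).symm⟩
  have hex : ∃ F : ℂ → ℂ, IsPhi21Continuation A B C Q F := ⟨F, hFc⟩
  have hG := hex.choose_spec
  rw [phi21, dif_pos hex]
  have hopen := isOpen_phi21Domain hQ
  have h0 : (0 : ℂ) ∈ phi21Domain Q := ball_subset_phi21Domain hQ (by simp)
  -- `phi21` is an arbitrary choice of continuation; the identity theorem forces its values.
  refine (hG.1.analyticOnNhd hopen).eqOn_of_preconnected_of_eventuallyEq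
    (hFc.1.analyticOnNhd hopen) isPreconnected_phi21Domain h0 ?_ hw
  filter_upwards [Metric.ball_mem_nhds (0 : ℂ) one_pos] with v hv
  rw [hG.2 v (mem_ball_zero_iff.mp hv), hFc.2 v (mem_ball_zero_iff.mp hv)]

end phi21

/-! ### The triple series and its sum over `ℤ`. -/

section bilateral

variable {Q : ℂ}

lemma qTheta_mul_zpow (hQ : ‖Q‖ < 1) (hQ0 : Q ≠ 0) {x : ℂ} (hx : x ≠ 0) (n : ℤ) :
    qTheta (x * Q ^ n) Q * thetaTerm Q x n = qTheta x Q := by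
  have hstep : ∀ n : ℤ, qTheta (x * Q ^ (n + 1)) Q * thetaTerm Q x (n + 1) =
      qTheta (x * Q ^ n) Q * thetaTerm Q x n := by
    intro n
    have h0 := zpow_ne_zero n hQ0
    rw [thetaTerm_add_one hQ0 hx, zpow_add_one₀ hQ0, ← mul_assoc x,
      qTheta_mul hQ hQ0 (mul_ne_zero hx h0)]
    field_simp
  induction n with
  | zero => simp [thetaTerm_zero]
  | succ n ih => rw [hstep, ih]
  | pred n ih => rw [← hstep, sub_add_cancel, ih]

lemma mul_zpow_mem_phi21Domain (hQ0 : Q ≠ 0) {κ : ℂ} (hκ : ∀ k : ℤ, κ ≠ Q ^ k) (j : ℤ) :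
    κ * Q ^ j ∈ phi21Domain Q := by
  intro k h
  refine hκ (-(j + k)) ?_
  rw [zpow_neg, zpow_add₀ hQ0, zpow_natCast]
  exact eq_inv_of_mul_eq_one_left (by rw [← h, mul_assoc])

lemma inv_ne_zpow {κ : ℂ} (hκ : ∀ k : ℤ, κ ≠ Q ^ k) (k : ℤ) : κ⁻¹ ≠ Q ^ k := fun h ↦
  hκ (-k) (by rw [zpow_neg, ← h, inv_inv])

lemma exists_norm_inv_qPochInf_nat_le (hQ : ‖Q‖ < 1) (κ : ℂ) :
    ∃ M : ℝ, ∀ n : ℕ, ‖(qPochInf (κ * Q ^ (n : ℤ)) Q)⁻¹‖ ≤ M := by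
  have ht : Tendsto (fun n : ℕ ↦ κ * Q ^ (n : ℤ)) atTop (𝓝 0) := by
    simpa using (tendsto_pow_atTop_nhds_zero_of_norm_lt_one hQ).const_mul κ
  have h := (((differentiable_qPochInf hQ).continuous.tendsto 0 |>.comp ht).inv₀
    (qPochInf_ne_zero_of_norm_lt hQ (by simp))).norm
  obtain ⟨M, hM⟩ := h.bddAbove_range
  exact ⟨M, fun j ↦ hM ⟨j, rfl⟩⟩

/-- Each step to `n + 1` multiplies the product by `1 - κ Q ^ (-(n+1))`, whose norm tends to
infinity. After division by `r ^ n` the ratio test still has limit `0`, so the quotients are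
summable, hence bounded. -/
lemma exists_norm_inv_qPochInf_neg_le (hQ : ‖Q‖ < 1) (hQ0 : Q ≠ 0) {κ : ℂ} (hκ0 : κ ≠ 0)
    (hκ : ∀ k : ℤ, κ ≠ Q ^ k) {r : ℝ} (hr : 0 < r) :
    ∃ M : ℝ, ∀ n : ℕ, ‖(qPochInf (κ * Q ^ (-(n : ℤ))) Q)⁻¹‖ ≤ M * r ^ n := by
  set a : ℕ → ℂ := fun n ↦ (qPochInf (κ * Q ^ (-(n : ℤ))) Q)⁻¹ * ((r : ℂ) ^ n)⁻¹ with ha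
  have hr0 : (r : ℂ) ≠ 0 := by exact_mod_cast hr.ne'
  have hP : ∀ n : ℕ, qPochInf (κ * Q ^ (-(n : ℤ))) Q ≠ 0 := fun n ↦
    qPochInf_ne_zero hQ (mul_zpow_mem_phi21Domain hQ0 hκ _)
  have hrec : ∀ n : ℕ, qPochInf (κ * Q ^ (-((n + 1 : ℕ) : ℤ))) Q =
      (1 - κ * (Q ^ (n + 1))⁻¹) * qPochInf (κ * Q ^ (-(n : ℤ))) Q := by
    intro n
    rw [qPochInf_eq_one_sub_mul hQ, zpow_neg, zpow_natCast, zpow_neg, zpow_natCast]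
    congr 2
    rw [pow_succ]
    field_simp
  have hs : Summable a := by
    refine summable_of_ratio_test_tendsto_lt_one zero_lt_one (Eventually.of_forall fun n ↦
      mul_ne_zero (inv_ne_zero (hP n)) (inv_ne_zero (pow_ne_zero _ hr0))) ?_
    have hQn : Tendsto (fun n : ℕ ↦ Q ^ (n + 1)) atTop (𝓝 0) :=
      (tendsto_pow_atTop_nhds_zero_of_norm_lt_one hQ).comp (tendsto_add_atTop_nat 1)
    have ht : Tendsto (fun n : ℕ ↦ ‖Q ^ (n + 1) / ((Q ^ (n + 1) - κ) * r)‖) atTop (𝓝 0) := by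
      simpa using (hQn.div ((hQn.sub_const κ).mul_const (r : ℂ))
        (mul_ne_zero (by simpa using hκ0) hr0)).norm
    refine ht.congr fun n ↦ ?_
    rw [← norm_div]
    congr 1
    have h1 := hP (n + 1)
    simp only [ha]
    rw [hrec] at h1 ⊢
    have h2 := left_ne_zero_of_mul h1
    have h3 := hP n
    have h4 := pow_ne_zero (n + 1) hQ0
    have h5 : Q ^ (n + 1) - κ ≠ 0 := fun h ↦ h2 (by
      rw [← sub_eq_zero.mp h, mul_inv_cancel₀ h4, sub_self])
    have h6 : 1 - κ * (Q ^ (n + 1))⁻¹ = (Q ^ (n + 1) - κ) / Q ^ (n + 1) := by field_simp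
    rw [h6]
    field_simp
    ring
  obtain ⟨M, hM⟩ := hs.tendsto_atTop_zero.norm.bddAbove_range
  refine ⟨M, fun n ↦ ?_⟩
  have h := hM ⟨n, rfl⟩
  simp only [ha, norm_mul, norm_inv, norm_pow, Complex.norm_real, Real.norm_of_nonneg hr.le] at h
  rw [norm_inv]
  rwa [← div_eq_mul_inv, div_le_iff₀ (by positivity)] at h

/-- `1 / (κ Q ^ j; Q)_∞` decays faster than any exponential as `j → -∞`. -/
lemma exists_norm_inv_qPochInf_zpow_le (hQ : ‖Q‖ < 1) (hQ0 : Q ≠ 0) {κ : ℂ} (hκ0 : κ ≠ 0)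
    (hκ : ∀ k : ℤ, κ ≠ Q ^ k) {r : ℝ} (hr : 0 < r) (hr1 : r ≤ 1) :
    ∃ M : ℝ, 0 ≤ M ∧ ∀ j : ℤ, ‖(qPochInf (κ * Q ^ j) Q)⁻¹‖ ≤ M * r ^ (-j) := by
  obtain ⟨M₁, h₁⟩ := exists_norm_inv_qPochInf_nat_le hQ κ
  obtain ⟨M₂, h₂⟩ := exists_norm_inv_qPochInf_neg_le hQ hQ0 hκ0 hκ hr
  have hM : 0 ≤ max M₁ M₂ := le_max_of_le_left ((norm_nonneg _).trans (h₁ 0))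
  refine ⟨max M₁ M₂, hM, fun j ↦ ?_⟩
  obtain ⟨n, rfl | rfl⟩ := j.eq_nat_or_neg
  · refine ((h₁ n).trans (le_max_left _ _)).trans (le_mul_of_one_le_right hM ?_)
    rw [zpow_neg, zpow_natCast]
    exact (one_le_inv₀ (by positivity)).mpr (pow_le_one₀ hr.le hr1)
  · rw [neg_neg, zpow_natCast]
    exact (h₂ n).trans (by gcongr; exact le_max_right _ _)

/-- A geometric sequence on each half of `ℤ`. -/
noncomputable def twoSidedGeom (σ τ : ℝ) (n : ℤ) : ℝ := if 0 ≤ n then σ ^ n else τ ^ n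

lemma summable_twoSidedGeom {σ τ : ℝ} (hσ0 : 0 ≤ σ) (hσ : σ < 1) (hτ : 1 < τ) :
    Summable (twoSidedGeom σ τ) := by
  refine Summable.of_nat_of_neg_add_one ?_ ?_
  · simpa [twoSidedGeom] using summable_geometric_of_lt_one hσ0 hσ
  · have h := (summable_nat_add_iff 1).mpr
      (summable_geometric_of_lt_one (inv_nonneg.mpr (zero_le_one.trans hτ.le))
        (inv_lt_one_of_one_lt₀ hτ))
    refine h.congr fun n ↦ ?_
    rw [twoSidedGeom, if_neg (by omega), zpow_neg, inv_pow]
    norm_cast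

/-- The summand of the triple series obtained by expanding both `₂φ₁` factors. -/
noncomputable def tripleTerm (Q κ z : ℂ) (e e' : ℕ → ℂ) (p : ℤ × ℕ × ℕ) : ℂ :=
  e p.2.1 * (qPochInf (κ * Q ^ (1 - p.1) * Q ^ p.2.1) Q)⁻¹ *
    (e' p.2.2 * (qPochInf (Q ^ p.1 / κ * Q ^ p.2.2) Q)⁻¹) * z ^ p.1

/-- For `n ≥ 0` the first reciprocal product decays like `r ^ n` at the cost of `r ^ (-m)`, and `r
‖z‖ < 1` gives a geometric series. For `n < 0` the second one decays like `r' ^ (-n)` at the cost of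
`r' ^ (-l)`, and `r' < ‖z‖` is used. The costs are absorbed by the weighted summability of `e` and
`e'`. -/
lemma summable_tripleTerm (hQ : ‖Q‖ < 1) (hQ0 : Q ≠ 0) {κ z : ℂ} (hκ0 : κ ≠ 0)
    (hκ : ∀ k : ℤ, κ ≠ Q ^ k) (hz : z ≠ 0) {e e' : ℕ → ℂ} {r r' : ℝ} (hr0 : 0 < r) (hr1 : r ≤ 1)
    (hrz : r * ‖z‖ < 1) (hr0' : 0 < r') (hr1' : r' ≤ 1) (hrz' : r' < ‖z‖)
    (he : Summable fun m ↦ ‖e m‖ * (r⁻¹) ^ m) (he' : Summable fun m ↦ ‖e' m‖ * (r'⁻¹) ^ m) :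
    Summable (tripleTerm Q κ z e e') := by
  have hκi := inv_ne_zpow hκ
  obtain ⟨M₁, hM₁, h₁⟩ := exists_norm_inv_qPochInf_zpow_le hQ hQ0 hκ0 hκ hr0 hr1
  obtain ⟨M₂, hM₂, h₂⟩ := exists_norm_inv_qPochInf_zpow_le hQ hQ0 hκ0 hκ one_pos le_rfl
  obtain ⟨M₃, hM₃, h₃⟩ :=
    exists_norm_inv_qPochInf_zpow_le hQ hQ0 (inv_ne_zero hκ0) hκi hr0' hr1'
  obtain ⟨M₄, hM₄, h₄⟩ :=
    exists_norm_inv_qPochInf_zpow_le hQ hQ0 (inv_ne_zero hκ0) hκi one_pos le_rfl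
  simp only [one_zpow, mul_one] at h₂ h₄
  have hzpos : 0 < ‖z‖ := norm_pos_iff.mpr hz
  have hone : ∀ m : ℕ, 1 ≤ (r⁻¹) ^ m := fun m ↦ one_le_pow₀ ((one_le_inv₀ hr0).mpr hr1)
  have hone' : ∀ m : ℕ, 1 ≤ (r'⁻¹) ^ m := fun m ↦ one_le_pow₀ ((one_le_inv₀ hr0').mpr hr1')
  have hg : Summable (twoSidedGeom (r * ‖z‖) (‖z‖ / r')) :=
    summable_twoSidedGeom (by positivity) hrz ((one_lt_div hr0').mpr hrz')
  have hg0 : ∀ n, 0 ≤ twoSidedGeom (r * ‖z‖) (‖z‖ / r') n := fun n ↦ by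
    unfold twoSidedGeom; split_ifs <;> positivity
  have hee := he.mul_of_nonneg he' (fun _ ↦ by positivity) (fun _ ↦ by positivity)
  have hb := (hg.mul_of_nonneg hee hg0 (fun _ ↦ by positivity)).mul_left
    (M₁ * r⁻¹ * M₄ + M₂ * M₃)
  refine Summable.of_norm_bounded hb fun ⟨n, m, l⟩ ↦ ?_
  have e1 : κ * Q ^ (1 - n) * Q ^ m = κ * Q ^ (1 - n + m) := by
    rw [zpow_add₀ hQ0, zpow_natCast, mul_assoc]
  have e2 : Q ^ n / κ * Q ^ l = κ⁻¹ * Q ^ (n + l) := by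
    rw [zpow_add₀ hQ0, zpow_natCast]; ring
  simp only [tripleTerm, norm_mul, norm_zpow]
  rw [e1, e2]
  have key : ‖(qPochInf (κ * Q ^ (1 - n + m)) Q)⁻¹‖ * ‖(qPochInf (κ⁻¹ * Q ^ (n + l)) Q)⁻¹‖ *
      ‖z‖ ^ n ≤ (M₁ * r⁻¹ * M₄ + M₂ * M₃) * (twoSidedGeom (r * ‖z‖) (‖z‖ / r') n *
        ((r⁻¹) ^ m * (r'⁻¹) ^ l)) := by
    by_cases hn : 0 ≤ n
    · calc _ ≤ (M₁ * r ^ (-(1 - n + m))) * M₄ * ‖z‖ ^ n := by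
            gcongr
            · exact h₁ _
            · exact h₄ _
        _ = (M₁ * r⁻¹ * M₄) * ((r * ‖z‖) ^ n * ((r⁻¹) ^ m * 1)) := by
            rw [neg_add, neg_sub, zpow_add₀ hr0.ne', zpow_sub₀ hr0.ne', zpow_neg, zpow_one,
              zpow_natCast, mul_zpow, inv_pow]
            ring
        _ ≤ _ := by
            rw [twoSidedGeom, if_pos hn]
            gcongr
            · exact le_add_of_nonneg_right (by positivity)
            · exact hone' l
    · calc _ ≤ M₂ * (M₃ * r' ^ (-(n + l))) * ‖z‖ ^ n := by
            gcongr
            · exact h₂ _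
            · exact h₃ _
        _ = (M₂ * M₃) * ((‖z‖ / r') ^ n * (1 * (r'⁻¹) ^ l)) := by
            rw [neg_add, zpow_add₀ hr0'.ne', zpow_neg, zpow_neg, zpow_natCast, div_zpow, inv_pow]
            ring
        _ ≤ _ := by
            rw [twoSidedGeom, if_neg hn]
            gcongr
            · exact le_add_of_nonneg_left (by positivity)
            · exact hone m
  calc _ = ‖e m‖ * ‖e' l‖ * (‖(qPochInf (κ * Q ^ (1 - n + m)) Q)⁻¹‖ *
        ‖(qPochInf (κ⁻¹ * Q ^ (n + l)) Q)⁻¹‖ * ‖z‖ ^ n) := by ring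
    _ ≤ ‖e m‖ * ‖e' l‖ * ((M₁ * r⁻¹ * M₄ + M₂ * M₃) *
        (twoSidedGeom (r * ‖z‖) (‖z‖ / r') n * ((r⁻¹) ^ m * (r'⁻¹) ^ l))) := by gcongr
    _ = _ := by ring

/-- Since `(κ Q ^ (1-n))_∞ (Q ^ n / κ)_∞ = θ(Q ^ n / κ)`, quasi-periodicity gives `θ(1/κ)` over a
theta term, and the shift by `p` leaves a finite product. -/
lemma inv_mul_inv_mul_zpow (hQ : ‖Q‖ < 1) (hQ0 : Q ≠ 0) {κ : ℂ} (z : ℂ) (hκ0 : κ ≠ 0)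
    (hκ : ∀ k : ℤ, κ ≠ Q ^ k) (p : ℕ) (n : ℤ) :
    (qPochInf (κ * Q ^ (1 - n) * Q ^ p) Q)⁻¹ * (qPochInf (Q ^ n / κ) Q)⁻¹ * z ^ n =
      (qTheta (1 / κ) Q)⁻¹ * thetaPochTerm Q p κ z n := by
  have h1 := qPochInf_eq_mul hQ (κ * Q ^ (1 - n)) p
  have hd := mul_zpow_mem_phi21Domain hQ0 hκ (1 - n)
  have h2 := qPochInf_ne_zero hQ (mul_pow_mem_phi21Domain hd p)
  have hκn := zpow_ne_zero n hQ0
  have h3 : qPochInf (Q ^ n / κ) Q ≠ 0 := by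
    rw [show Q ^ n / κ = κ⁻¹ * Q ^ n by ring]
    exact qPochInf_ne_zero hQ (mul_zpow_mem_phi21Domain hQ0 (inv_ne_zpow hκ) n)
  have h4 := qTheta_mul_zpow hQ hQ0 (one_div_ne_zero hκ0) n
  have h5 : qTheta (1 / κ * Q ^ n) Q =
      qPochInf (Q ^ n / κ) Q * qPochInf (κ * Q ^ (1 - n)) Q := by
    rw [qTheta, zpow_sub₀ hQ0, zpow_one]
    congr 2
    · ring
    · field_simp
  have h6 : thetaTerm Q (z / κ) n = z ^ n * thetaTerm Q (1 / κ) n := by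
    rw [thetaTerm, thetaTerm, show -(z / κ) = z * -(1 / κ) by ring, mul_zpow, mul_assoc]
  have h7 : qTheta (1 / κ) Q ≠ 0 :=
    qTheta_ne_zero hQ hQ0 (one_div_ne_zero hκ0) (by simpa using inv_ne_zpow hκ)
  rw [thetaPochTerm, h6]
  rw [h5, h1] at h4
  rw [inv_mul_eq_div (qTheta (1 / κ) Q), eq_div_iff h7, ← h4]
  field_simp

/-- Replacing `n` by `n + l` makes the sum depend on `m` and `l` only through `m + l`, apart from a
factor `z ^ (-l)`. -/
lemma hasSum_tripleTerm_int (hQ : ‖Q‖ < 1) (hQ0 : Q ≠ 0) {κ z : ℂ} (hκ0 : κ ≠ 0)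
    (hκ : ∀ k : ℤ, κ ≠ Q ^ k) (hz : z ≠ 0) (hzQ : ∀ k : ℤ, z ≠ Q ^ k) (e e' : ℕ → ℂ)
    (m l : ℕ) :
    HasSum (fun n : ℤ ↦ tripleTerm Q κ z e e' (n, m, l))
      (qTheta (z / κ) Q / (qTheta (1 / κ) Q * qTheta z Q) *
        (e m * (e' l * (z⁻¹) ^ l) * thetaPoch Q (m + l) 1 z)) := by
  have h1 := (summable_norm_thetaPochTerm hQ hQ0 (m + l) hκ0 hz).of_norm.hasSum
  have h2 := ((Equiv.addRight (l : ℤ)).hasSum_iff.mpr h1).mul_left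
    ((qTheta (1 / κ) Q)⁻¹ * (e m * e' l * (z⁻¹) ^ l))
  refine h2.of_eq (fun n ↦ ?_) ?_
  · have h := inv_mul_inv_mul_zpow hQ hQ0 z hκ0 hκ (m + l) (n + l)
    have e1 : κ * Q ^ (1 - (n + l)) * Q ^ (m + l) = κ * Q ^ (1 - n) * Q ^ m := by
      rw [pow_add, show 1 - (n + l) = (1 - n) - (l : ℤ) by ring, zpow_sub₀ hQ0 _ (l : ℤ),
        zpow_natCast]
      field_simp
    have e2 : Q ^ (n + l) / κ = Q ^ n / κ * Q ^ l := by
      rw [zpow_add₀ hQ0, zpow_natCast]; ring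
    rw [e1, e2, zpow_add₀ hz, zpow_natCast] at h
    have e3 : (z ^ l) * (z⁻¹) ^ l = 1 := by rw [← mul_pow, mul_inv_cancel₀ hz, one_pow]
    simp only [tripleTerm, Function.comp, Equiv.coe_addRight]
    calc _ = e m * e' l * ((qPochInf (κ * Q ^ (1 - n) * Q ^ m) Q)⁻¹ *
          (qPochInf (Q ^ n / κ * Q ^ l) Q)⁻¹ * (z ^ n * (z ^ l * (z⁻¹) ^ l))) := by
            rw [e3]; ring
      _ = e m * e' l * (z⁻¹) ^ l * ((qTheta (1 / κ) Q)⁻¹ *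
          thetaPochTerm Q (m + l) κ z (n + l)) := by rw [← h]; ring
      _ = _ := by ring
  · have h := qTheta_mul_thetaPoch hQ hQ0 (m + l) hκ0 hz
    have h7 : qTheta (1 / κ) Q ≠ 0 :=
      qTheta_ne_zero hQ hQ0 (one_div_ne_zero hκ0) (by simpa using inv_ne_zpow hκ)
    have h8 := qTheta_ne_zero hQ hQ0 hz hzQ
    have h9 : thetaPoch Q (m + l) κ z =
        qTheta (z / κ) Q * thetaPoch Q (m + l) 1 z / qTheta z Q := by
      rw [eq_div_iff h8, ← h]; ring
    change _ = _ * thetaPoch Q (m + l) κ z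
    rw [h9]
    field_simp

end bilateral

/-! ### Decoupling the double series into a `₄φ₃`. -/

section resummation

variable {Q : ℂ}

/-- Write `tailSum` as a sum over `k` and sum over `m`, `l` first: the `k`-th term contains them
only as `(Q ^ k) ^ m (Q ^ k) ^ l`. -/
lemma hasSum_mul_tailSum (hQ : ‖Q‖ < 1) {a b : ℕ → ℂ} {α β : ℕ → ℂ} (x : ℂ)
    (ha : Summable fun m ↦ ‖a m‖) (hb : Summable fun m ↦ ‖b m‖)
    (hα : ∀ k : ℕ, HasSum (fun m ↦ a m * (Q ^ k) ^ m) (α k))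
    (hβ : ∀ k : ℕ, HasSum (fun m ↦ b m * (Q ^ k) ^ m) (β k)) :
    HasSum (fun p : ℕ × ℕ ↦ a p.1 * b p.2 * tailSum Q (p.1 + p.2) x)
      (∑' k, tailTerm Q 0 x k * (α k * β k)) := by
  have hsplit : ∀ m l k, tailTerm Q (m + l) x k =
      (Q ^ k) ^ m * (Q ^ k) ^ l * tailTerm Q 0 x k := by
    intro m l k
    simp only [tailTerm]
    rw [← pow_mul, ← pow_mul, ← pow_mul, ← pow_mul]
    ring
  have hle : ∀ m k : ℕ, ‖(Q ^ k) ^ m‖ ≤ 1 := fun m k ↦ by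
    rw [← pow_mul, norm_pow]; exact pow_le_one₀ (norm_nonneg _) hQ.le
  have hle' : ∀ (c : ℕ → ℂ) (m k : ℕ), ‖c m * (Q ^ k) ^ m‖ ≤ ‖c m‖ := fun c m k ↦ by
    rw [norm_mul]; exact mul_le_of_le_one_right (norm_nonneg _) (hle m k)
  have hab := ha.mul_of_nonneg hb (fun _ ↦ norm_nonneg _) (fun _ ↦ norm_nonneg _)
  have hsum : Summable fun p : (ℕ × ℕ) × ℕ ↦
      a p.1.1 * b p.1.2 * tailTerm Q (p.1.1 + p.1.2) x p.2 := by
    refine Summable.of_norm_bounded (hab.mul_of_nonneg (summable_norm_tailTerm hQ 0 x)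
      (fun _ ↦ by positivity) (fun _ ↦ norm_nonneg _)) fun ⟨⟨m, l⟩, k⟩ ↦ ?_
    simp only
    rw [hsplit]
    calc _ = ‖a m * (Q ^ k) ^ m‖ * ‖b l * (Q ^ k) ^ l‖ * ‖tailTerm Q 0 x k‖ := by
          rw [← norm_mul, ← norm_mul]; congr 1; ring
      _ ≤ _ := by
          gcongr
          · exact hle' a m k
          · exact hle' b l k
  have h1 : ∀ p : ℕ × ℕ, HasSum (fun k ↦ a p.1 * b p.2 * tailTerm Q (p.1 + p.2) x k)
      (a p.1 * b p.2 * tailSum Q (p.1 + p.2) x) := fun p ↦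
    (summable_norm_tailTerm hQ _ x).of_norm.hasSum.mul_left _
  have h2 : ∀ k : ℕ, HasSum (fun p : ℕ × ℕ ↦ a p.1 * b p.2 * tailTerm Q (p.1 + p.2) x k)
      (tailTerm Q 0 x k * (α k * β k)) := fun k ↦ by
    have h := hasSum_mul_prod (hα k) (hβ k)
      (Summable.of_nonneg_of_le (fun _ ↦ norm_nonneg _) (fun m ↦ hle' a m k) ha)
      (Summable.of_nonneg_of_le (fun _ ↦ norm_nonneg _) (fun m ↦ hle' b m k) hb)
    refine (h.mul_left (tailTerm Q 0 x k)).of_eq (fun p ↦ ?_) rfl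
    rw [hsplit]
    ring
  have h3 := hsum.hasSum.prod_fiberwise h1
  have h4 := HasSum.prod_fiberwise ((Equiv.prodComm ℕ (ℕ × ℕ)).hasSum_iff.mpr hsum.hasSum) h2
  rw [h4.tsum_eq]
  exact h3

/-- The sum `∑ₖ Q ^ k (xQ^{k+1})_∞ / (Q)ₖ` weighted by two quotients of infinite products is
a `₄φ₃`. -/
lemma tsum_tailTerm_mul (hQ : ‖Q‖ < 1) {x A B C A' B' C' : ℂ} (hx : ∀ n, qPoch (x * Q) Q n ≠ 0)
    (hA : ‖A‖ < 1) (hB : ‖B‖ < 1) (hC : ‖C‖ < 1)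
    (hA' : ‖A'‖ < 1) (hB' : ‖B'‖ < 1) (hC' : ‖C'‖ < 1) :
    ∑' k : ℕ, tailTerm Q 0 x k *
      (qPochInf (C * Q ^ k) Q / (qPochInf (A * Q ^ k) Q * qPochInf (B * Q ^ k) Q) *
        (qPochInf (C' * Q ^ k) Q / (qPochInf (A' * Q ^ k) Q * qPochInf (B' * Q ^ k) Q))) =
      qPochInf (x * Q) Q * qPochInf C Q * qPochInf C' Q /
        (qPochInf A Q * qPochInf B Q * qPochInf A' Q * qPochInf B' Q) *
        phi43 A B A' B' C C' (x * Q) Q Q := by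
  rw [phi43, ← tsum_mul_left]
  refine tsum_congr fun k ↦ ?_
  have a0 := qPoch_ne_zero_of_norm_lt hQ hQ k
  have a1 := qPoch_ne_zero_of_norm_lt hQ hA k
  have a2 := qPoch_ne_zero_of_norm_lt hQ hB k
  have a3 := qPoch_ne_zero_of_norm_lt hQ hC k
  have a4 := qPoch_ne_zero_of_norm_lt hQ hA' k
  have a5 := qPoch_ne_zero_of_norm_lt hQ hB' k
  have a6 := qPoch_ne_zero_of_norm_lt hQ hC' k
  have b1 := qPochInf_ne_zero_of_norm_lt hQ hA
  have b2 := qPochInf_ne_zero_of_norm_lt hQ hB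
  have b4 := qPochInf_ne_zero_of_norm_lt hQ hA'
  have b5 := qPochInf_ne_zero_of_norm_lt hQ hB'
  have a7 := hx k
  rw [tailTerm, qPochInf_mul_pow_eq_div hQ a1, qPochInf_mul_pow_eq_div hQ a2,
    qPochInf_mul_pow_eq_div hQ a3, qPochInf_mul_pow_eq_div hQ a4,
    qPochInf_mul_pow_eq_div hQ a5, qPochInf_mul_pow_eq_div hQ a6, qPochInf_mul_pow_eq_div hQ a7,
    zero_add, pow_one]
  field_simp

end resummation

/-! ### The bilateral sum of products of two `₂φ₁`. -/

section bilateralProduct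

variable {Q : ℂ}

lemma summable_norm_ratioCoeff_mul (hQ : ‖Q‖ < 1) {A B : ℂ} (C : ℂ) {x : ℂ}
    (hA : ‖A * x‖ < 1) (hB : ‖B * x‖ < 1) :
    Summable fun m ↦ ‖ratioCoeff A B C Q m * x ^ m‖ := by
  refine (hasSum_ratioCoeff hQ C (le_max_left ‖A‖ ‖B‖) (le_max_right ‖A‖ ‖B‖)
    ?_).summable.norm
  rw [norm_mul] at hA hB
  rw [mul_max_of_nonneg _ _ (norm_nonneg x), mul_comm, mul_comm ‖x‖]
  exact max_lt hA hB

lemma hasSum_ratioCoeff_mul_pow (hQ : ‖Q‖ < 1) {A B : ℂ} (C : ℂ) {x : ℂ}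
    (hA : ‖A * x‖ < 1) (hB : ‖B * x‖ < 1) (k : ℕ) :
    HasSum (fun m ↦ ratioCoeff A B C Q m * x ^ m * (Q ^ k) ^ m)
      (qPochInf (C * x * Q ^ k) Q /
        (qPochInf (A * x * Q ^ k) Q * qPochInf (B * x * Q ^ k) Q)) := by
  have hle : ∀ D : ℂ, ‖D * (x * Q ^ k)‖ ≤ ‖D * x‖ := fun D ↦ by
    rw [← mul_assoc, norm_mul _ (Q ^ k), norm_pow]
    exact mul_le_of_le_one_right (norm_nonneg _) (pow_le_one₀ (norm_nonneg _) hQ.le)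
  have hA1 := (hle A).trans_lt hA
  have hB1 := (hle B).trans_lt hB
  have h := hasSum_ratioCoeff hQ C (le_max_left ‖A‖ ‖B‖) (le_max_right ‖A‖ ‖B‖)
    (x := x * Q ^ k) (by
      rw [norm_mul] at hA1 hB1
      rw [mul_max_of_nonneg _ _ (norm_nonneg _), mul_comm, mul_comm ‖x * Q ^ k‖]
      exact max_lt hA1 hB1)
  simp only [← mul_assoc] at h
  exact h.of_eq (fun m ↦ by rw [mul_pow, mul_assoc]) rfl

lemma summable_norm_mul_inv_pow (hQ : ‖Q‖ < 1) {A B C : ℂ} {r : ℝ} (hr : 0 < r)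
    (hAr : ‖A‖ < r) (hBr : ‖B‖ < r) :
    Summable fun m ↦ ‖ratioCoeff A B C Q m‖ * (r⁻¹) ^ m := by
  have hlt : ∀ {D : ℂ}, ‖D‖ < r → ‖D * ((r⁻¹ : ℝ) : ℂ)‖ < 1 := fun {D} hD ↦ by
    rw [norm_mul, Complex.norm_real, Real.norm_of_nonneg (by positivity), ← div_eq_mul_inv]
    exact (div_lt_one hr).mpr hD
  have h := summable_norm_ratioCoeff_mul hQ C (hlt hAr) (hlt hBr)
  refine h.congr fun m ↦ ?_
  rw [norm_mul, norm_pow, Complex.norm_real, Real.norm_of_nonneg (by positivity)]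

/-- The bilateral series of products of two `₂φ₁`, evaluated as a double series. -/
lemma hasSum_phi21_mul_phi21_aux (hQ : ‖Q‖ < 1) (hQ0 : Q ≠ 0) {κ z A B C A' B' C' : ℂ}
    (hκ0 : κ ≠ 0) (hκ : ∀ k : ℤ, κ ≠ Q ^ k) (hz : z ≠ 0) (hzQ : ∀ k : ℤ, z ≠ Q ^ k)
    (hA : ‖A‖ < 1) (hB : ‖B‖ < 1) (hC : ‖C‖ < 1)
    (hA' : ‖A'‖ < 1) (hB' : ‖B'‖ < 1) (hC' : ‖C'‖ < 1)
    (hAz : ‖A * z‖ < 1) (hBz : ‖B * z‖ < 1)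
    (hAz' : ‖A' * z⁻¹‖ < 1) (hBz' : ‖B' * z⁻¹‖ < 1) :
    HasSum (fun n : ℤ ↦ phi21 A B C Q (κ * Q ^ (1 - n)) * phi21 A' B' C' Q (Q ^ n / κ) * z ^ n)
      (qPochInf A Q * qPochInf B Q / qPochInf C Q *
        (qPochInf A' Q * qPochInf B' Q / qPochInf C' Q) *
        ∑' p : ℕ × ℕ, qTheta (z / κ) Q / (qTheta (1 / κ) Q * qTheta z Q) *
          (ratioCoeff A B C Q p.1 * (ratioCoeff A' B' C' Q p.2 * (z⁻¹) ^ p.2) *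
            thetaPoch Q (p.1 + p.2) 1 z)) := by
  have hz0 : 0 < ‖z‖ := norm_pos_iff.mpr hz
  have hlt : ∀ {D : ℂ}, ‖D * z‖ < 1 → ‖D‖ < 1 / ‖z‖ := fun {D} h ↦ by
    rwa [lt_div_iff₀ hz0, ← norm_mul]
  have hlt' : ∀ {D : ℂ}, ‖D * z⁻¹‖ < 1 → ‖D‖ < ‖z‖ := fun {D} h ↦ by
    rwa [norm_mul, norm_inv, ← div_eq_mul_inv, div_lt_one hz0] at h
  -- `r` must exceed `‖A‖`, `‖B‖` for the weighted Taylor coefficients to be summable, and stay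
  -- below `1 / ‖z‖` for convergence in `n`; `r'` plays the same role for the second factor, with
  -- `‖z‖`.
  obtain ⟨r, hr₁, hr₂⟩ := exists_between (show max ‖A‖ ‖B‖ < min 1 (1 / ‖z‖) from
    max_lt (lt_min hA (hlt hAz)) (lt_min hB (hlt hBz)))
  obtain ⟨r', hr₁', hr₂'⟩ := exists_between (show max ‖A'‖ ‖B'‖ < min 1 ‖z‖ from
    max_lt (lt_min hA' (hlt' hAz')) (lt_min hB' (hlt' hBz')))
  obtain ⟨hAr, hBr⟩ := max_lt_iff.mp hr₁
  obtain ⟨hAr', hBr'⟩ := max_lt_iff.mp hr₁'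
  obtain ⟨hr1, hrz⟩ := lt_min_iff.mp hr₂
  obtain ⟨hr1', hrz'⟩ := lt_min_iff.mp hr₂'
  have hr0 := (norm_nonneg _).trans_lt hAr
  have hr0' := (norm_nonneg _).trans_lt hAr'
  have hsum := summable_tripleTerm hQ hQ0 hκ0 hκ hz hr0 hr1.le ((lt_div_iff₀ hz0).mp hrz)
    hr0' hr1'.le hrz' (summable_norm_mul_inv_pow (C := C) hQ hr0 hAr hBr)
    (summable_norm_mul_inv_pow (C := C') hQ hr0' hAr' hBr')
  have he : Summable fun m ↦ ‖ratioCoeff A B C Q m‖ := by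
    simpa using summable_norm_ratioCoeff_mul hQ C (x := 1) (by simpa) (by simpa)
  have he' : Summable fun m ↦ ‖ratioCoeff A' B' C' Q m‖ := by
    simpa using summable_norm_ratioCoeff_mul hQ C' (x := 1) (by simpa) (by simpa)
  have hd : ∀ n : ℤ, κ * Q ^ (1 - n) ∈ phi21Domain Q := fun n ↦
    mul_zpow_mem_phi21Domain hQ0 hκ _
  have hd' : ∀ n : ℤ, Q ^ n / κ ∈ phi21Domain Q := fun n ↦ by
    rw [show Q ^ n / κ = κ⁻¹ * Q ^ n by ring]
    exact mul_zpow_mem_phi21Domain hQ0 (inv_ne_zpow hκ) n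
  have h1 := hsum.hasSum.prod_fiberwise fun n ↦ (hasSum_mul_prod
    (summable_mul_inv_qPochInf hQ he (hd n)).of_norm.hasSum
    (summable_mul_inv_qPochInf hQ he' (hd' n)).of_norm.hasSum
    (summable_mul_inv_qPochInf hQ he (hd n))
    (summable_mul_inv_qPochInf hQ he' (hd' n))).mul_right (z ^ n)
  have h2 := HasSum.prod_fiberwise ((Equiv.prodComm (ℕ × ℕ) ℤ).hasSum_iff.mpr hsum.hasSum)
    fun p ↦ hasSum_tripleTerm_int hQ hQ0 hκ0 hκ hz hzQ (ratioCoeff A B C Q)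
      (ratioCoeff A' B' C' Q) p.1 p.2
  rw [← h2.tsum_eq] at h1
  refine (h1.mul_left (qPochInf A Q * qPochInf B Q / qPochInf C Q *
    (qPochInf A' Q * qPochInf B' Q / qPochInf C' Q))).of_eq (fun n ↦ ?_) rfl
  rw [phi21_eq hQ (le_max_left ‖A‖ ‖B‖) (le_max_right ‖A‖ ‖B‖) (max_lt hA hB) hC (hd n),
    phi21_eq hQ (le_max_left ‖A'‖ ‖B'‖) (le_max_right ‖A'‖ ‖B'‖) (max_lt hA' hB') hC' (hd' n)]
  ring

/-- A bilateral series of products of two `₂φ₁` is a sum of two `₄φ₃`. -/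
theorem hasSum_phi21_mul_phi21 (hQ : ‖Q‖ < 1) (hQ0 : Q ≠ 0) {κ z A B C A' B' C' : ℂ}
    (hκ0 : κ ≠ 0) (hκ : ∀ k : ℤ, κ ≠ Q ^ k) (hz : z ≠ 0) (hzQ : ∀ k : ℤ, z ≠ Q ^ k)
    (hA : ‖A‖ < 1) (hB : ‖B‖ < 1) (hC : ‖C‖ < 1)
    (hA' : ‖A'‖ < 1) (hB' : ‖B'‖ < 1) (hC' : ‖C'‖ < 1)
    (hAz : ‖A * z‖ < 1) (hBz : ‖B * z‖ < 1) (hCz : ‖C * z‖ < 1)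
    (hAz' : ‖A' * z⁻¹‖ < 1) (hBz' : ‖B' * z⁻¹‖ < 1) (hCz' : ‖C' * z⁻¹‖ < 1) :
    HasSum (fun n : ℤ ↦ phi21 A B C Q (κ * Q ^ (1 - n)) * phi21 A' B' C' Q (Q ^ n / κ) * z ^ n)
      (qPochInf Q Q * qPochInf (C' * z⁻¹) Q * qPochInf A' Q * qPochInf B' Q * qTheta (z / κ) Q /
          (qPochInf z Q * qPochInf C' Q * qPochInf (A' * z⁻¹) Q * qPochInf (B' * z⁻¹) Q *
            qTheta (1 / κ) Q) *
          phi43 A B (A' * z⁻¹) (B' * z⁻¹) C (C' * z⁻¹) (z⁻¹ * Q) Q Q +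
        qPochInf Q Q * qPochInf (C * z) Q * qPochInf A Q * qPochInf B Q * qTheta (z / κ) Q /
          (qPochInf C Q * qPochInf z⁻¹ Q * qPochInf (A * z) Q * qPochInf (B * z) Q *
            qTheta (1 / κ) Q) *
          phi43 (A * z) (B * z) A' B' (C * z) C' (z * Q) Q Q) := by
  have hmain := hasSum_phi21_mul_phi21_aux hQ hQ0 hκ0 hκ hz hzQ hA hB hC hA' hB' hC' hAz hBz
    hAz' hBz'
  have he : Summable fun m ↦ ‖ratioCoeff A B C Q m‖ := by
    simpa using summable_norm_ratioCoeff_mul hQ C (x := 1) (by simpa) (by simpa)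
  have he' : Summable fun m ↦ ‖ratioCoeff A' B' C' Q m‖ := by
    simpa using summable_norm_ratioCoeff_mul hQ C' (x := 1) (by simpa) (by simpa)
  have hα : ∀ k, HasSum (fun m ↦ ratioCoeff A B C Q m * (Q ^ k) ^ m)
      (qPochInf (C * Q ^ k) Q / (qPochInf (A * Q ^ k) Q * qPochInf (B * Q ^ k) Q)) := fun k ↦ by
    simpa using hasSum_ratioCoeff_mul_pow hQ C (x := 1) (by simpa) (by simpa) k
  have hα' : ∀ k, HasSum (fun m ↦ ratioCoeff A' B' C' Q m * (Q ^ k) ^ m)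
      (qPochInf (C' * Q ^ k) Q / (qPochInf (A' * Q ^ k) Q * qPochInf (B' * Q ^ k) Q)) :=
    fun k ↦ by
      simpa using hasSum_ratioCoeff_mul_pow hQ C' (x := 1) (by simpa) (by simpa) k
  -- In the first tail the factor `z ^ (-l)` rescales the second Taylor series. In the second tail
  -- `z ^ (m+l+1) z ^ (-l) = z · z ^ m` rescales the first one instead.
  have h1 := hasSum_mul_tailSum hQ z⁻¹ he (summable_norm_ratioCoeff_mul hQ C' hAz' hBz') hα
    (hasSum_ratioCoeff_mul_pow hQ C' hAz' hBz')
  have h2 := hasSum_mul_tailSum hQ z (summable_norm_ratioCoeff_mul hQ C hAz hBz) he'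
    (hasSum_ratioCoeff_mul_pow hQ C hAz hBz) hα'
  have hx1 : ∀ j : ℕ, z⁻¹ * Q * Q ^ j ≠ 1 := fun j h ↦ hzQ (j + 1) (by
    rw [zpow_add_one₀ hQ0, zpow_natCast]
    field_simp at h
    linear_combination -h)
  have hx2 : ∀ j : ℕ, z * Q * Q ^ j ≠ 1 := fun j h ↦ hzQ (-(j + 1)) (by
    rw [zpow_neg, zpow_add_one₀ hQ0, zpow_natCast]
    exact eq_inv_of_mul_eq_one_left (by rw [← h]; ring))
  rw [tsum_tailTerm_mul hQ (qPoch_ne_zero hx1) hA hB hC hAz' hBz' hCz'] at h1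
  rw [tsum_tailTerm_mul hQ (qPoch_ne_zero hx2) hAz hBz hCz hA' hB' hC'] at h2
  have h3 := (h1.sub (h2.mul_left z)).mul_left
    (qTheta (z / κ) Q / (qTheta (1 / κ) Q * qTheta z Q) * qPochInf Q Q)
  have h4 := h3.of_eq (g := fun p : ℕ × ℕ ↦
    qTheta (z / κ) Q / (qTheta (1 / κ) Q * qTheta z Q) *
          (ratioCoeff A B C Q p.1 * (ratioCoeff A' B' C' Q p.2 * (z⁻¹) ^ p.2) *
            thetaPoch Q (p.1 + p.2) 1 z)) (fun p ↦ by
      rw [thetaPoch_one hQ hQ0 _ hz]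
      have e3 : (z ^ p.2) * (z⁻¹) ^ p.2 = 1 := by rw [← mul_pow, mul_inv_cancel₀ hz, one_pow]
      linear_combination (-(qTheta (z / κ) Q / (qTheta (1 / κ) Q * qTheta z Q) * qPochInf Q Q *
        ratioCoeff A B C Q p.1 * ratioCoeff A' B' C' Q p.2 * z ^ p.1 * z *
        tailSum Q (p.1 + p.2) z)) * e3) rfl
  rw [h4.tsum_eq] at hmain
  refine hmain.of_eq (fun _ ↦ rfl) ?_
  have t1 : qTheta z Q = qPochInf z Q * qPochInf (z⁻¹ * Q) Q := by
    rw [qTheta, show Q / z = z⁻¹ * Q by ring]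
  -- Inversion of theta: its sign turns the difference of the two tails into the sum of two `₄φ₃`.
  have t2 : z * (qPochInf z⁻¹ Q * qPochInf (z * Q) Q) = -qTheta z Q := by
    have h := qTheta_inv hQ hQ0 hz
    rw [qTheta, show Q / z⁻¹ = z * Q by field_simp] at h
    rw [h]
    field_simp
  have n1 : qPochInf (z⁻¹ * Q) Q ≠ 0 := qPochInf_ne_zero hQ hx1
  have n2 : qPochInf (z * Q) Q ≠ 0 := qPochInf_ne_zero hQ hx2
  have n3 := qTheta_ne_zero hQ hQ0 hz hzQ
  have n4 : qPochInf z Q ≠ 0 := by rw [t1] at n3; exact left_ne_zero_of_mul n3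
  have n5 : qPochInf z⁻¹ Q ≠ 0 := by
    intro h0
    rw [h0] at t2
    exact n3 (by linear_combination t2)
  have n6 : qTheta (1 / κ) Q ≠ 0 :=
    qTheta_ne_zero hQ hQ0 (one_div_ne_zero hκ0) (by simpa using inv_ne_zpow hκ)
  have m1 := qPochInf_ne_zero_of_norm_lt hQ hA
  have m2 := qPochInf_ne_zero_of_norm_lt hQ hB
  have m3 := qPochInf_ne_zero_of_norm_lt hQ hC
  have m4 := qPochInf_ne_zero_of_norm_lt hQ hA'
  have m5 := qPochInf_ne_zero_of_norm_lt hQ hB'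
  have m6 := qPochInf_ne_zero_of_norm_lt hQ hC'
  have m7 := qPochInf_ne_zero_of_norm_lt hQ hAz
  have m8 := qPochInf_ne_zero_of_norm_lt hQ hBz
  have m9 := qPochInf_ne_zero_of_norm_lt hQ hAz'
  have m10 := qPochInf_ne_zero_of_norm_lt hQ hBz'
  have k1 : qPochInf (z⁻¹ * Q) Q / qTheta z Q = 1 / qPochInf z Q := by
    rw [t1, div_eq_div_iff (mul_ne_zero n4 n1) n4]
    ring
  have k2 : z * qPochInf (z * Q) Q / qTheta z Q = -1 / qPochInf z⁻¹ Q := by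
    rw [div_eq_div_iff n3 n5]
    linear_combination t2
  generalize phi43 A B (A' * z⁻¹) (B' * z⁻¹) C (C' * z⁻¹) (z⁻¹ * Q) Q Q = P₁
  generalize phi43 (A * z) (B * z) A' B' (C * z) C' (z * Q) Q Q = P₂
  have g1 : qPochInf Q Q * qPochInf (C' * z⁻¹) Q * qPochInf A' Q * qPochInf B' Q *
      qTheta (z / κ) Q / (qPochInf z Q * qPochInf C' Q * qPochInf (A' * z⁻¹) Q *
        qPochInf (B' * z⁻¹) Q * qTheta (1 / κ) Q) * P₁ =
      qPochInf Q Q * qPochInf (C' * z⁻¹) Q * qPochInf A' Q * qPochInf B' Q *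
      qTheta (z / κ) Q / (qPochInf C' Q * qPochInf (A' * z⁻¹) Q *
        qPochInf (B' * z⁻¹) Q * qTheta (1 / κ) Q) * P₁ *
        (qPochInf (z⁻¹ * Q) Q / qTheta z Q) := by
    rw [k1]; field_simp
  have g2 : qPochInf Q Q * qPochInf (C * z) Q * qPochInf A Q * qPochInf B Q *
      qTheta (z / κ) Q / (qPochInf C Q * qPochInf z⁻¹ Q * qPochInf (A * z) Q *
        qPochInf (B * z) Q * qTheta (1 / κ) Q) * P₂ =
      -(qPochInf Q Q * qPochInf (C * z) Q * qPochInf A Q * qPochInf B Q *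
      qTheta (z / κ) Q / (qPochInf C Q * qPochInf (A * z) Q *
        qPochInf (B * z) Q * qTheta (1 / κ) Q) * P₂ *
        (z * qPochInf (z * Q) Q / qTheta z Q)) := by
    rw [k2]; field_simp
  rw [g1, g2]
  field_simp
  ring

end bilateralProduct

/-! ### Specialization to the Askey–Wilson parameters. -/

theorem mainTheorem8
    (q : ℝ) (hq0 : 0 < q) (hq1 : q < 1)
    (lam ε : ℝ) (s u t v x y : ℂ)
    (hs : s ≠ 0) (hu : u ≠ 0) (ht : t ≠ 0) (hv : v ≠ 0) (hx : x ≠ 0) (hy : y ≠ 0)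
    (hux : ‖u * x‖ ≤ q ^ 2) (hux' : ‖u / x‖ ≤ q ^ 2)
    (hvy : ‖v * y‖ ≤ q ^ 2) (hvy' : ‖v / y‖ ≤ q ^ 2)
    (hsu : ‖s / u‖ ≤ q) (htv : ‖t / v‖ ≤ q)
    (Q a b c d κ atil : ℂ)
    (hQ : Q = (q : ℂ) ^ 2)
    (ha : a = s * (q : ℂ) ^ (1 - 2 * Complex.I * (lam : ℂ)))
    (hb : b = s * (q : ℂ) ^ (1 + 2 * Complex.I * (lam : ℂ)))
    (hc : c = t * v * (q : ℂ) / u)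
    (hd : d = (q : ℂ) * v / (u * t))
    (hκ : κ = (q : ℂ) ^ (-1 - 2 * (ε : ℂ) + 2 * Complex.I * (lam : ℂ)))
    (hat : atil = s * v * (q : ℂ) / u)
    -- the denominators in the formula do not vanish:
    (hκQ : ∀ k : ℤ, κ ≠ Q ^ k) (hadQ : ∀ k : ℤ, a * d ≠ Q ^ k) :
    atil ^ 2 = a * b * c * d / Q ∧
    ∃ S : ℂ,
      HasSum (fun n : ℤ =>
        phi21 (a * x) (a / x) (a * b) Q (κ * Q ^ (1 - n)) *
          phi21 (b * c * y / atil) (b * c / (y * atil)) (c * Q / d) Q (Q ^ n / κ) *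
          (Q / (a * d)) ^ n) S ∧
      S =
        qPochInf Q Q * qPochInf (a * c) Q *
              qPochInf (b * c * y / atil) Q * qPochInf (b * c / (y * atil)) Q *
              qTheta (a * d * κ) Q /
            (qPochInf (Q / (a * d)) Q * qPochInf (c * Q / d) Q *
              qPochInf (atil * y) Q * qPochInf (atil / y) Q * qTheta (1 / κ) Q) *
            phi43 (a * x) (a / x) (atil * y) (atil / y) (a * b) (a * c) (a * d) Q Q +
          qPochInf Q Q * qPochInf (Q * b / d) Q *
              qPochInf (a * x) Q * qPochInf (a / x) Q * qTheta (a * d * κ) Q /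
            (qPochInf (a * b) Q * qPochInf (a * d / Q) Q *
              qPochInf (Q * x / d) Q * qPochInf (Q / (d * x)) Q * qTheta (1 / κ) Q) *
            phi43 (Q * x / d) (Q / (d * x)) (b * c * y / atil) (b * c / (y * atil))
              (Q * b / d) (Q * c / d) (Q ^ 2 / (a * d)) Q Q ∧
      S =
        qPochInf Q Q * qPochInf (b * c * y / atil) Q * qPochInf (b * c / (y * atil)) Q *
              qTheta (a * d * κ) Q /
            (qPochInf (a * b) Q * qPochInf (c * Q / d) Q *
              qPochInf (atil * y) Q * qPochInf (atil / y) Q * qTheta (1 / κ) Q) *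
          askeyWilson y x a b c d atil Q := by
  have hq : (q : ℂ) ≠ 0 := by exact_mod_cast hq0.ne'
  have hnq : ‖(q : ℂ)‖ = q := by rw [Complex.norm_real, Real.norm_of_nonneg hq0.le]
  have hQ0 : Q ≠ 0 := by rw [hQ]; exact pow_ne_zero _ hq
  have hQ1 : ‖Q‖ < 1 := by
    rw [hQ, norm_pow, hnq]; exact pow_lt_one₀ hq0.le hq1 two_ne_zero
  have hκ0 : κ ≠ 0 := by rw [hκ]; simp [Complex.cpow_eq_zero_iff, hq]
  -- Of the complex powers, only `|P| = |P'| = q` and `P P' = q²` are needed.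
  obtain ⟨P, hP⟩ : ∃ P, P = (q : ℂ) ^ (1 - 2 * Complex.I * (lam : ℂ)) := ⟨_, rfl⟩
  obtain ⟨P', hP'⟩ : ∃ P', P' = (q : ℂ) ^ (1 + 2 * Complex.I * (lam : ℂ)) := ⟨_, rfl⟩
  have hPP : P * P' = (q : ℂ) ^ 2 := by
    rw [hP, hP', ← Complex.cpow_add _ _ hq, ← Complex.cpow_ofNat]
    congr 1
    ring
  have hnP : ‖P‖ = q := by
    rw [hP, Complex.norm_cpow_eq_rpow_re_of_pos hq0]; simp
  have hnP' : ‖P'‖ = q := by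
    rw [hP', Complex.norm_cpow_eq_rpow_re_of_pos hq0]; simp
  have hP0 : P ≠ 0 := by rw [← norm_pos_iff, hnP]; exact hq0
  have hP0' : P' ≠ 0 := by rw [← norm_pos_iff, hnP']; exact hq0
  rw [← hP] at ha
  rw [← hP'] at hb
  have ha0 : a ≠ 0 := by rw [ha]; exact mul_ne_zero hs hP0
  have hb0 : b ≠ 0 := by rw [hb]; exact mul_ne_zero hs hP0'
  have hc0 : c ≠ 0 := by
    rw [hc]; exact div_ne_zero (mul_ne_zero (mul_ne_zero ht hv) hq) hu
  have hd0 : d ≠ 0 := by rw [hd]; exact div_ne_zero (mul_ne_zero hq hv) (mul_ne_zero hu ht)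
  have hat0 : atil ≠ 0 := by
    rw [hat]; exact div_ne_zero (mul_ne_zero (mul_ne_zero hs hv) hq) hu
  have hsq : atil ^ 2 = a * b * c * d / Q := by
    rw [hat, ha, hb, hc, hd, hQ, ← hPP]
    field_simp
  refine ⟨hsq, ?_⟩
  -- Every parameter below is written as a product of three factors of sizes at most `q`, `q²`, `q`,
  -- so its norm is at most `q⁴`.
  have hsmall : ∀ {w₁ w₂ w₃ : ℂ}, ‖w₁‖ ≤ q → ‖w₂‖ ≤ q ^ 2 → ‖w₃‖ ≤ q →
      ‖w₁ * w₂ * w₃‖ < 1 := by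
    intro w₁ w₂ w₃ h1 h2 h3
    rw [norm_mul, norm_mul]
    calc ‖w₁‖ * ‖w₂‖ * ‖w₃‖ ≤ q * q ^ 2 * q := by gcongr
      _ = q ^ 4 := by ring
      _ < 1 := pow_lt_one₀ hq0.le hq1 (by norm_num)
  have hsq_le : ∀ {w x : ℂ}, x ≠ 0 → ‖w * x‖ ≤ q ^ 2 → ‖w / x‖ ≤ q ^ 2 → ‖w‖ ≤ q ^ 2 := by
    intro w x hx h1 h2
    have h : ‖w‖ ^ 2 ≤ (q ^ 2) ^ 2 := by
      calc ‖w‖ ^ 2 = ‖w * x‖ * ‖w / x‖ := by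
            rw [← norm_mul, ← norm_pow]; congr 1; field_simp
        _ ≤ q ^ 2 * q ^ 2 := by gcongr
        _ = _ := by ring
    exact le_of_sq_le_sq h (by positivity)
  have hun : ‖u‖ ≤ q ^ 2 := hsq_le hx hux hux'
  have hvn : ‖v‖ ≤ q ^ 2 := hsq_le hy hvy hvy'
  have hq21 : q ^ 2 ≤ 1 := pow_le_one₀ hq0.le hq1.le
  have hsn : ‖s‖ ≤ q ^ 2 := by
    rw [show s = s / u * u by field_simp, norm_mul]
    calc _ ≤ q * q ^ 2 := by gcongr
      _ ≤ 1 * q ^ 2 := by gcongr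
      _ = _ := one_mul _
  have htn : ‖t‖ ≤ q ^ 2 := by
    rw [show t = t / v * v by field_simp, norm_mul]
    calc _ ≤ q * q ^ 2 := by gcongr
      _ ≤ 1 * q ^ 2 := by gcongr
      _ = _ := one_mul _
  set z : ℂ := Q / (a * d) with hzdef
  have had0 : a * d ≠ 0 := mul_ne_zero ha0 hd0
  have hz : z ≠ 0 := div_ne_zero hQ0 had0
  have hzi : z⁻¹ = a * d / Q := by rw [hzdef, inv_div]
  have hzQ : ∀ k : ℤ, z ≠ Q ^ k := by
    intro k h
    refine hadQ (1 - k) ?_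
    rw [zpow_sub₀ hQ0, zpow_one, ← h, hzdef]
    field_simp
  have hbc : b * c / atil = t * P' := by
    rw [hb, hc, hat]; field_simp
  -- the parameters of the two `₂φ₁` and their multiples by `z` and `z⁻¹`
  have eAz : a * x * z = Q * x / d := by rw [hzdef]; field_simp
  have eBz : a / x * z = Q / (d * x) := by rw [hzdef]; field_simp
  have eCz : a * b * z = Q * b / d := by rw [hzdef]; field_simp
  -- The relation defining `atil` is what makes multiplication by `z⁻¹` carry `bcy^{±1}/atil` to
  -- `atil y^{±1}`.
  have hbcad : b * c * (a * d / Q) = atil ^ 2 := by rw [hsq]; ring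
  have eAz' : b * c * y / atil * z⁻¹ = atil * y := by
    rw [hzi, show b * c * y / atil * (a * d / Q) = b * c * (a * d / Q) * y / atil by ring, hbcad]
    field_simp
  have eBz' : b * c / (y * atil) * z⁻¹ = atil / y := by
    rw [hzi, show b * c / (y * atil) * (a * d / Q) = b * c * (a * d / Q) / (y * atil) by ring,
      hbcad]
    field_simp
  have eCz' : c * Q / d * z⁻¹ = a * c := by rw [hzi]; field_simp
  have eQz' : z⁻¹ * Q = a * d := by rw [hzi]; field_simp
  have eQz : z * Q = Q ^ 2 / (a * d) := by rw [hzdef]; ring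
  have hA : ‖a * x‖ < 1 := by
    rw [show a * x = s / u * (u * x) * P by rw [ha]; field_simp]
    exact hsmall hsu hux hnP.le
  have hB : ‖a / x‖ < 1 := by
    rw [show a / x = s / u * (u / x) * P by rw [ha]; field_simp]
    exact hsmall hsu hux' hnP.le
  have hC : ‖a * b‖ < 1 := by
    rw [show a * b = P * s * (s * P') by rw [ha, hb]; ring]
    refine hsmall hnP.le hsn ?_
    rw [norm_mul, hnP']
    exact mul_le_of_le_one_left hq0.le (hsn.trans hq21)
  have hA' : ‖b * c * y / atil‖ < 1 := by
    rw [show b * c * y / atil = t / v * (v * y) * P' by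
      rw [mul_div_right_comm, hbc]; field_simp]
    exact hsmall htv hvy hnP'.le
  have hB' : ‖b * c / (y * atil)‖ < 1 := by
    rw [show b * c / (y * atil) = t / v * (v / y) * P' by
      rw [mul_comm y, ← div_div, hbc]; field_simp]
    exact hsmall htv hvy' hnP'.le
  have hC' : ‖c * Q / d‖ < 1 := by
    rw [show c * Q / d = q * t * (t * q) by rw [hc, hd, hQ]; field_simp]
    refine hsmall hnq.le htn ?_
    rw [norm_mul, hnq]
    exact mul_le_of_le_one_left hq0.le (htn.trans hq21)
  have hAz : ‖a * x * z‖ < 1 := by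
    rw [eAz, show Q * x / d = t / v * (u * x) * q by rw [hQ, hd]; field_simp]
    exact hsmall htv hux hnq.le
  have hBz : ‖a / x * z‖ < 1 := by
    rw [eBz, show Q / (d * x) = t / v * (u / x) * q by rw [hQ, hd]; field_simp]
    exact hsmall htv hux' hnq.le
  have hCz : ‖a * b * z‖ < 1 := by
    rw [eCz, show Q * b / d = t / v * u * (s * q * P') by rw [hQ, hd, hb]; field_simp]
    refine hsmall htv hun ?_
    rw [norm_mul, norm_mul, hnq, hnP']
    calc ‖s‖ * q * q ≤ 1 * q * 1 := by gcongr; exact hsn.trans hq21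
      _ = q := by ring
  have hAz' : ‖b * c * y / atil * z⁻¹‖ < 1 := by
    rw [eAz', show atil * y = s / u * (v * y) * q by rw [hat]; field_simp]
    exact hsmall hsu hvy hnq.le
  have hBz' : ‖b * c / (y * atil) * z⁻¹‖ < 1 := by
    rw [eBz', show atil / y = s / u * (v / y) * q by rw [hat]; field_simp]
    exact hsmall hsu hvy' hnq.le
  have hCz' : ‖c * Q / d * z⁻¹‖ < 1 := by
    rw [eCz', show a * c = s / u * v * (t * q * P) by rw [ha, hc]; field_simp]
    refine hsmall hsu hvn ?_
    rw [norm_mul, norm_mul, hnq, hnP]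
    calc ‖t‖ * q * q ≤ 1 * q * 1 := by gcongr; exact htn.trans hq21
      _ = q := by ring
  have hmain := hasSum_phi21_mul_phi21 hQ1 hQ0 hκ0 hκQ hz hzQ hA hB hC hA' hB' hC' hAz hBz hCz
    hAz' hBz' hCz'
  have hθ : qTheta (z / κ) Q = qTheta (a * d * κ) Q := by
    rw [← qTheta_inv_symm hQ0 (a * d * κ)]
    congr 1
    rw [hzdef, div_div]
  have m1 := qPochInf_ne_zero_of_norm_lt hQ1 hC
  have m2 := qPochInf_ne_zero_of_norm_lt hQ1 hA'
  have m3 := qPochInf_ne_zero_of_norm_lt hQ1 hB'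
  have m4 := qPochInf_ne_zero_of_norm_lt hQ1 hC'
  have m5 := qPochInf_ne_zero_of_norm_lt hQ1 hAz'
  have m6 := qPochInf_ne_zero_of_norm_lt hQ1 hBz'
  rw [eAz'] at m5
  rw [eBz'] at m6
  rw [eAz, eBz, eCz, eAz', eBz', eCz', eQz', eQz, hθ, hzi] at hmain
  have eQc : Q * c / d = c * Q / d := by ring
  rw [askeyWilson, eQc, ← hzdef]
  refine ⟨_, hmain, rfl, ?_⟩
  -- By the same relation, the dual parameters `Q γ^{±1} / (ad/atil)` of the Askey–Wilson function
  -- at `γ = y` are the numerator parameters of the second `₂φ₁`. The two closed forms then differ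
  -- only by a common prefactor.
  have hdt : a * d / atil = Q * atil / (b * c) := by
    field_simp
    rw [hsq]
    field_simp
  have f1 : Q * y / (a * d / atil) = b * c * y / atil := by
    rw [hdt]; field_simp
  have f2 : Q / ((a * d / atil) * y) = b * c / (y * atil) := by
    rw [hdt]; field_simp
  rw [f1, f2]
  generalize qPochInf (a * b) Q = X1 at *
  generalize qPochInf (b * c * y / atil) Q = X2 at *
  generalize qPochInf (b * c / (y * atil)) Q = X3 at *
  generalize qPochInf (c * Q / d) Q = X4 at *
  generalize qPochInf (atil * y) Q = X5 at *
  generalize qPochInf (atil / y) Q = X6 at *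
  generalize qPochInf (a * c) Q = Y1
  generalize qPochInf z Q = Y2
  generalize qPochInf (a * d / Q) Q = Y3
  generalize qPochInf (Q * x / d) Q = Y4
  generalize qPochInf (Q / (d * x)) Q = Y5
  generalize qPochInf (Q * b / d) Q = Y6
  generalize qPochInf (a * x) Q = Y7
  generalize qPochInf (a / x) Q = Y8
  generalize phi43 (a * x) _ _ _ _ _ _ _ _ = Z1
  generalize phi43 _ _ _ _ _ _ _ _ _ = Z2
  field_simp
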